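/- Let $q$ be a prime power and let $f$ be a non-degenerate hermitian form on an $n$-dimensional vector space $V$ over $\mathbb{F}_{q^2}$ (that is, $f$ is linear in the first argument, semilinear in the second with respect to an automorphism $\theta\neq 1$ of $\mathbb{F}_{q^2}$ with $\theta^2=1$, satisfies $f(v,w)=f(w,v)^{\theta}$, and has trivial radical $\{v\in V\mid f(v,w)=0\ \forall w\in V\}$). A $j$-dimensional subspace (a $j$-space) of $V$ is called $i$-singular if the radical of the restriction of $f$ to it has dimension $i$, and non-singular if it is $0$-singular. For integers $b\ge 0$, $a\geq 0$ put $$\varphi^{\pm}_{a,b}(q)=\prod_{k=a}^{b}\left(q^{k}\pm(-1)^{k}\right)$$ (an empty product being $1$), and for $0\le a\le b$ put $${b \brack a}^{-}_{q}=\frac{\varphi^{-}_{b-a+1,b}(q)}{\varphi^{-}_{1,a}(q)} .$$ Let $i,j$ be integers with $0\leq i\leq\min\{j,n-j\}$ and $j\leq n-1$, and let $\pi$ be an $i$-singular $j$-space of $V$. Let $\gamma_{i,j,n}$ be the number of non-singular $(n-j)$-spaces $\sigma$ of $V$ such that $\sigma\cap\pi$ is trivial and $\langle\pi,\sigma\rangle$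 is a non-singular $n$-space (so $\langle\pi,\sigma\rangle=V$). Then, for every such $f$ and $\pi$, $$\gamma_{i,j,n}=q^{2j(n-j)-\binom{j+1}{2}}\,\varphi^{+}_{1,i}(q)\sum_{m=0}^{j-i}(-1)^{m(n-j)}\,\varphi^{+}_{i+1,j-m}(q)\,{j-i \brack m}^{-}_{q}\,q^{\binom{m}{2}-m(n-j-i)} .$$ -/

import Mathlib

open Module

namespace HermitianAnzahl

section Forms

variable {K V : Type*} [Field K] [AddCommGroup V] [Module K V] {θ : K ≃+* K}

/-- A hermitian form: a map `f`, linear in the first argument and `θ`-semilinear in the second, for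
an automorphism `θ ≠ 1` with `θ² = 1`, such that `f(v,w) = f(w,v)^θ`. -/
structure IsHermitian (f : V →ₗ[K] V →ₛₗ[(θ : K →+* K)] K) : Prop where
  ne_one : θ ≠ 1
  sq_eq_one : θ ^ 2 = 1
  symm : ∀ v w : V, f v w = θ (f w v)

/-- The radical `{v | ∀ w, f(v,w) = 0}` of a form. -/
def radical (f : V →ₗ[K] V →ₛₗ[(θ : K →+* K)] K) : Submodule K V where
  carrier := {v | ∀ w : V, f v w = 0}
  add_mem' := fun {a b} ha hb w => by
    have h1 : f a w = 0 := ha w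
    have h2 : f b w = 0 := hb w
    simp [h1, h2]
  zero_mem' := fun w => by simp
  smul_mem' := fun c a ha w => by
    have h1 : f a w = 0 := ha w
    simp [h1]

/-- The form is non-degenerate if its radical is trivial. -/
def IsNondegenerate (f : V →ₗ[K] V →ₛₗ[(θ : K →+* K)] K) : Prop :=
  radical f = ⊥

/-- The restriction of the form to a subspace. -/
def restrict (f : V →ₗ[K] V →ₛₗ[(θ : K →+* K)] K) (W : Submodule K V) :
    W →ₗ[K] W →ₛₗ[(θ : K →+* K)] K :=
  f.domRestrict₁₂ W W

/-- `W` is an `i`-singular `j`-space: it has dimension `j`, and the restriction of `f` to `W` has an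
`i`-dimensional radical. -/
def IsSingularSpace (f : V →ₗ[K] V →ₛₗ[(θ : K →+* K)] K) (i j : ℕ) (W : Submodule K V) : Prop :=
  finrank K W = j ∧ finrank K (radical (restrict f W)) = i

/-- The number of non-singular `k`-spaces `σ` that meet the `j`-space `π` trivially and such that
the span of `π` and `σ` is a non-singular `(k+j)`-space. -/
noncomputable def gammaCount (f : V →ₗ[K] V →ₛₗ[(θ : K →+* K)] K) (π : Submodule K V)
    (j k : ℕ) : ℕ :=
  Nat.card {σ : Submodule K V //
    IsSingularSpace f 0 k σ ∧ σ ⊓ π = ⊥ ∧ IsSingularSpace f 0 (k + j) (π ⊔ σ)}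

end Forms

/-- `φ⁺_{a,b}(x) = ∏_{k=a}^{b} (x^k + (-1)^k)`. -/
def phiPlus (a b : ℕ) (x : ℚ) : ℚ :=
  ∏ k ∈ Finset.Icc a b, (x ^ k + (-1) ^ k)

/-- `φ⁻_{a,b}(x) = ∏_{k=a}^{b} (x^k - (-1)^k)`. -/
def phiMinus (a b : ℕ) (x : ℚ) : ℚ :=
  ∏ k ∈ Finset.Icc a b, (x ^ k - (-1) ^ k)

/-- `[b, a]⁻_x = φ⁻_{b-a+1,b}(x) / φ⁻_{1,a}(x)` for `a ≤ b`, and `0` otherwise. -/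
def gaussMinus (b a : ℕ) (x : ℚ) : ℚ :=
  if a ≤ b then phiMinus (b - a + 1) b x / phiMinus 1 a x else 0

end HermitianAnzahl

namespace HermitianAnzahl

open Finset Matrix
open scoped Classical

/-! Write `j = i + m` and `n = j + i + d`, and fix a basis `u` of `π`. A complement of `π` is the
orthogonal space of exactly one family `t` dual to `u`, and it is non-singular iff the Gram matrix
of `t` is invertible (`gammaCount_eq_card_dual`). So `γ` counts dual families with invertible Gram
matrix.

Choose `u` as a basis of the radical followed by `m` orthonormal vectors, and complete it to an
adapted frame. In frame coordinates `(C, x)` the Gram matrix of a dual family is `G + [C 0] + [C 0]ᴴ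
+ ∑ xₖ xₖᴴ` with `d` summands, where the last `m × m` block of `G` is the identity. As `C` varies,
`G + [C 0] + [C 0]ᴴ` runs uniformly over the hermitian extensions `B` of `I_m` to size `j`. Hence `γ
= q^(2j(n-j)) p(m, d)`, where `p(m, d)` is the probability that a random such `B` plus `d` random
matrices `x xᴴ` is invertible.

A sum of a congruence-invariant function over the extensions of a block depends only on the
congruence class of the block. Adding `x xᴴ` turns the block `I_(m+1)` into `I + y yᴴ`, which is
congruent to `I`, or to `diag(0, I_m)` when `yᴴ y = -1`. The sum for `diag(0, I_m)` is eliminated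
through the sum for the smaller block `I_m`. This gives `p(m+1, d+1) = r p(m+1, d) + (1 - r) p(m,
d)` with `r = (-q)^(-(m+1))` (`CongrInvariant.extSum_rankOneSum`).

The boundary values come from counting invertible hermitian matrices: `p(m, 0) = ∏_{l ≤ j-m} (1 +
(-q)^(-l))` and `p(0, d) = p(0, 0)`. The sum `complementSum (-q) j m d` has the same recursion and
boundary values, and it is the stated formula rewritten in powers of `-q`. -/

theorem sum_comp_addMonoidHom {A B : Type*} [AddCommGroup A] [Fintype A] [AddCommGroup B]
    [Fintype B] (φ : A →+ B) (hφ : Function.Surjective φ) (h : B → ℚ) :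
    (∑ a, h (φ a)) * Fintype.card B = Fintype.card A * ∑ b, h b := by
  have hfib : ∀ b, #{a | φ a = b} = #{a | φ a = 0} := fun b =>
    AddMonoidHom.card_fiber_eq_of_mem_range φ (hφ b) (hφ 0)
  have hcard : Fintype.card A = Fintype.card B * #{a | φ a = 0} := by
    rw [← Finset.card_univ, Finset.card_eq_sum_card_fiberwise (f := φ) (t := univ) (by simp)]
    simp [hfib]
  have hsum : ∑ a, h (φ a) = #{a | φ a = 0} * ∑ b, h b := by
    rw [← Finset.sum_fiberwise univ φ (fun a => h (φ a)), Finset.mul_sum]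
    refine Finset.sum_congr rfl fun b _ => ?_
    rw [Finset.sum_congr rfl (g := fun _ => h b) (by simp +contextual), Finset.sum_const, hfib,
      nsmul_eq_mul]
  rw [hsum, hcard]
  push_cast
  ring

/-! ### Trace and norm of the involution on a field of order `q²`. -/

section Field

variable {K : Type*} [Field K] [Fintype K] [StarRing K]

/-- A nonzero trace is fixed by `star`, so dividing by it gives trace `1`. If all traces vanished,
then `2 = 0` and `star x = -x = x`. No case split on the characteristic is needed. -/
theorem exists_add_star_eq_one (hs : ∃ x : K, star x ≠ x) : ∃ e : K, e + star e = 1 := by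
  by_contra! h
  have h0 : ∀ e : K, e + star e = 0 := by
    intro e
    by_contra he
    refine h (e / (e + star e)) ?_
    rw [star_div₀, star_add, star_star, add_comm (star e) e, ← add_div, div_self he]
  obtain ⟨x, hx⟩ := hs
  have h1 := h0 1
  have hx' := h0 x
  rw [star_one] at h1
  apply hx
  linear_combination hx' - x * h1

/-- The additive map `y ↦ y - star y` has the fixed field as kernel and a scalar multiple of the
fixed field as image, so `q²` is the square of its order. -/
theorem card_fixed {q : ℕ} (hK : Fintype.card K = q ^ 2) (hs : ∃ x : K, star x ≠ x) :
    #{x : K | star x = x} = q := by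
  obtain ⟨x, hx⟩ := hs
  let D : K →+ K := AddMonoidHom.id K - (starAddEquiv : K ≃+ K).toAddMonoidHom
  have hD : ∀ y, D y = y - star y := fun y => rfl
  have hx' : x - star x ≠ 0 := sub_ne_zero.2 (Ne.symm hx)
  have h1 : Nat.card D.ker = #{x : K | star x = x} := by
    rw [Nat.card_eq_fintype_card, Fintype.card_subtype]
    congr 1; ext y
    simp only [AddMonoidHom.mem_ker, hD, sub_eq_zero, mem_filter, mem_univ, true_and]
    exact eq_comm
  have h2 : Nat.card D.range = #{x : K | star x = x} := by
    rw [Nat.card_eq_fintype_card, Fintype.card_subtype]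
    refine Finset.card_bij' (fun y _ => y / (x - star x)) (fun c _ => c * (x - star x)) ?_ ?_ ?_ ?_
    · simp only [mem_filter, mem_univ, true_and, AddMonoidHom.mem_range]
      rintro _ ⟨z, rfl⟩
      rw [hD, star_div₀, star_sub, star_sub, star_star, star_star,
        ← neg_sub z, ← neg_sub x, neg_div_neg_eq]
    · simp only [mem_filter, mem_univ, true_and, AddMonoidHom.mem_range]
      intro c hc
      exact ⟨c * x, by rw [hD, star_mul', hc]; ring⟩
    · intro y _; field_simp
    · intro y _; field_simp
  have h3 := AddSubgroup.card_mul_index D.ker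
  rw [AddSubgroup.index_ker, h1, h2, Nat.card_eq_fintype_card, hK, sq] at h3
  exact Nat.mul_self_inj.1 h3

/-- By Hilbert 90 the kernel of the norm is the image of `x ↦ x / star x`. Comparing orders, the
norm maps onto the fixed units, and each of its fibres has `(q² - 1) / (q - 1)` elements. -/
theorem card_norm_eq {q : ℕ} (hK : Fintype.card K = q ^ 2) (hs : ∃ x : K, star x ≠ x)
    {t : K} (ht : star t = t) (ht0 : t ≠ 0) : #{x : K | x * star x = t} = q + 1 := by
  let st : Kˣ →* Kˣ := ⟨⟨fun x => star x, star_one _⟩, fun x y => by simp [star_mul, mul_comm]⟩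
  have hst : ∀ x, st x = star x := fun x => rfl
  let φ : Kˣ →* Kˣ := MonoidHom.id _ / st
  let ψ : Kˣ →* Kˣ := MonoidHom.id _ * st
  have hφ : ∀ x, φ x = x / star x := fun x => rfl
  have hψ : ∀ x, ψ x = x * star x := fun x => rfl
  have h90 : φ.range = ψ.ker := by
    ext u
    rw [MonoidHom.mem_range, MonoidHom.mem_ker, hψ]
    constructor
    · rintro ⟨x, rfl⟩
      rw [hφ, star_div, star_star]
      simp
    · intro hu
      have hu' : (u : K) * star (u : K) = 1 := by
        have := congrArg Units.val hu
        simpa using this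
      -- The Hilbert 90 resolvent. If it vanished identically, `a = 1` would give `u = -1`, and then
      -- `star` would be trivial.
      obtain ⟨a, ha⟩ : ∃ a : K, a + u * star a ≠ 0 := by
        by_contra! h
        obtain ⟨x, hx⟩ := hs
        have h1 := h 1
        rw [star_one] at h1
        apply hx
        linear_combination -h x + star x * h1
      refine ⟨Units.mk0 _ ha, ?_⟩
      rw [hφ, div_eq_iff_eq_mul]
      ext
      simp only [Units.val_mk0, Units.val_mul, Units.coe_star, star_add, star_mul', star_star]
      linear_combination (-a) * hu'
  have hle : ψ.range ≤ φ.ker := by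
    rintro _ ⟨x, rfl⟩
    rw [MonoidHom.mem_ker, hφ, hψ, star_mul, star_star]
    simp
  have h1 := Subgroup.card_mul_index φ.ker
  have h2 := Subgroup.card_mul_index ψ.ker
  rw [Subgroup.index_ker] at h1 h2
  have hpos : 0 < Nat.card ψ.ker := Nat.card_pos
  have heq : Nat.card ψ.range = Nat.card φ.ker := by
    rw [← h1, h90, mul_comm] at h2
    exact Nat.eq_of_mul_eq_mul_right hpos h2
  have hrange : ψ.range = φ.ker := Subgroup.eq_of_le_of_card_ge hle heq.ge
  have hfix : Nat.card φ.ker + 1 = q := by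
    rw [← card_fixed hK hs, ← Finset.card_erase_add_one (a := (0 : K)) (by simp)]
    congr 1
    rw [Nat.card_eq_fintype_card, Fintype.card_subtype]
    refine Finset.card_bij (fun u _ => (u : K)) ?_ ?_ ?_
    · intro u hu
      simp only [mem_filter, mem_univ, true_and, MonoidHom.mem_ker, hφ, div_eq_one, mem_erase,
        ne_eq, Units.ne_zero, not_false_eq_true] at hu ⊢
      exact (congrArg Units.val hu).symm
    · intro a _ b _ h; exact Units.ext h
    · intro b hb
      simp only [mem_filter, mem_univ, true_and, mem_erase] at hb
      refine ⟨Units.mk0 b hb.1, ?_, rfl⟩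
      simp only [mem_filter, mem_univ, true_and, MonoidHom.mem_ker, hφ, div_eq_one]
      exact Units.ext hb.2.symm
  have hker : Nat.card ψ.ker = q + 1 := by
    have h3 : Nat.card Kˣ + 1 = q ^ 2 := by
      rw [← hK, Nat.card_eq_fintype_card, Fintype.card_units]
      have := Fintype.card_pos (α := K)
      omega
    have hp : 0 < Nat.card φ.ker := Nat.card_pos
    rw [heq] at h2
    rw [← hfix] at h3 ⊢
    apply Nat.eq_of_mul_eq_mul_right hp
    nlinarith
  have hmem : Units.mk0 t ht0 ∈ ψ.range := by
    rw [hrange, MonoidHom.mem_ker, hφ, div_eq_one]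
    exact Units.ext ht.symm
  have hfib := MonoidHom.card_fiber_eq_of_mem_range ψ hmem ⟨1, map_one ψ⟩
  rw [← hker, Nat.card_eq_fintype_card, Fintype.card_subtype]
  simp only [MonoidHom.mem_ker]
  rw [← hfib]
  symm
  refine Finset.card_bij (fun u _ => (u : K)) ?_ ?_ ?_
  · intro u hu
    simp only [mem_filter, mem_univ, true_and, hψ] at hu ⊢
    simpa using congrArg Units.val hu
  · intro a _ b _ h; exact Units.ext h
  · intro b hb
    simp only [mem_filter, mem_univ, true_and] at hb
    have hb0 : b ≠ 0 := by rintro rfl; simp at hb; exact ht0 hb.symm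
    refine ⟨Units.mk0 b hb0, ?_, rfl⟩
    simp only [mem_filter, mem_univ, true_and, hψ]
    exact Units.ext (by simpa using hb)

theorem exists_norm_eq {q : ℕ} (hK : Fintype.card K = q ^ 2) (hs : ∃ x : K, star x ≠ x)
    {t : K} (ht : star t = t) : ∃ x : K, x * star x = t := by
  by_cases ht0 : t = 0
  · exact ⟨0, by simp [ht0]⟩
  · have h := card_norm_eq hK hs ht ht0
    have hpos : 0 < #{x : K | x * star x = t} := by omega
    obtain ⟨x, hx⟩ := Finset.card_pos.1 hpos
    exact ⟨x, by simpa using hx⟩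

end Field

/-! ### Gram–Schmidt for hermitian forms. -/

section Orthonormal

variable {K V : Type*} [Field K] [AddCommGroup V] [Module K V]
  {σ : K →+* K}

/-- The Gram matrix of the family `z` has trivial left kernel. -/
def GramNondegenerate (f : V →ₗ[K] V →ₛₗ[σ] K) {ζ : Type*} [Fintype ζ] (z : ζ → V) : Prop :=
  ∀ c : ζ → K, (∀ b, ∑ a, c a * f (z a) (z b) = 0) → c = 0

variable {f : V →ₗ[K] V →ₛₗ[σ] K} {ζ : Type*} [Fintype ζ] {z : ζ → V}

theorem GramNondegenerate.exists_sub_orthogonal (hz : GramNondegenerate f z) (v : V) :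
    ∃ s : ζ → K, ∀ b, f (v - ∑ a, s a • z a) (z b) = 0 := by
  let M : (ζ → K) →ₗ[K] (ζ → K) :=
    { toFun := fun c b => ∑ a, c a * f (z a) (z b)
      map_add' := fun c c' => by ext b; simp [add_mul, Finset.sum_add_distrib]
      map_smul' := fun r c => by ext b; simp [Finset.mul_sum, mul_assoc] }
  have hM : Function.Injective M := by
    rw [injective_iff_map_eq_zero]
    intro c hc
    exact hz c fun b => congrFun hc b
  obtain ⟨s, hs⟩ := LinearMap.injective_iff_surjective.1 hM (fun b => f v (z b))
  refine ⟨s, fun b => ?_⟩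
  have := congrFun hs b
  simp only [map_sub, LinearMap.sub_apply, map_sum, map_smul, LinearMap.sum_apply,
    LinearMap.smul_apply, smul_eq_mul]
  rw [sub_eq_zero]
  exact this.symm

theorem GramNondegenerate.linearIndependent (hz : GramNondegenerate f z) :
    LinearIndependent K z := by
  rw [Fintype.linearIndependent_iff]
  intro c hc
  refine congrFun (hz c fun b => ?_)
  have h : f (∑ a, c a • z a) (z b) = 0 := by rw [hc]; simp
  simpa only [map_sum, map_smul, LinearMap.sum_apply, LinearMap.smul_apply, smul_eq_mul] using h

variable [Fintype K] [StarRing K] [FiniteDimensional K V]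

/-- The orthogonal space of `z` is nonzero by dimension, and it cannot be totally isotropic, because
the form is non-degenerate on it. A non-isotropic vector is then rescaled using surjectivity of the
norm. -/
theorem GramNondegenerate.exists_unit_orthogonal (hz : GramNondegenerate f z) {q : ℕ}
    (hK : Fintype.card K = q ^ 2) (hs : ∃ x : K, star x ≠ x) (hσ : ∀ x, σ x = star x)
    (hsymm : ∀ v w, f v w = star (f w v)) (hnd : ∀ v, (∀ w, f v w = 0) → v = 0)
    (hlt : Fintype.card ζ < finrank K V) :
    ∃ v, (∀ b, f v (z b) = 0) ∧ f v v = 1 := by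
  suffices h : ∃ v, (∀ b, f v (z b) = 0) ∧ f v v ≠ 0 by
    obtain ⟨v, hv, hvv⟩ := h
    obtain ⟨c, hc⟩ := exists_norm_eq hK hs (t := (f v v)⁻¹) (by rw [star_inv₀, ← hsymm])
    refine ⟨c • v, fun b => by simp [hv b], ?_⟩
    simp only [map_smul, LinearMap.smul_apply, map_smulₛₗ, hσ, smul_eq_mul]
    rw [← mul_assoc, mul_comm (star c), hc, inv_mul_cancel₀ hvv]
  let L : V →ₗ[K] (ζ → K) := LinearMap.pi fun b =>
    { toFun := fun v => f v (z b)
      map_add' := fun v w => by simp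
      map_smul' := fun r v => by simp }
  have hL : ∀ v b, L v b = f v (z b) := fun _ _ => rfl
  have hker : LinearMap.ker L ≠ ⊥ := LinearMap.ker_ne_bot_of_finrank_lt (by simpa using hlt)
  obtain ⟨u, hu, hu0⟩ := Submodule.exists_mem_ne_zero_of_ne_bot hker
  have hu' : ∀ b, f u (z b) = 0 := fun b => by rw [← hL, LinearMap.mem_ker.1 hu]; rfl
  by_contra! hcon
  have huw : ∃ w, f u w ≠ 0 := by
    by_contra! h
    exact hu0 (hnd u h)
  obtain ⟨w, hw⟩ := huw
  obtain ⟨s, hsw⟩ := hz.exists_sub_orthogonal w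
  set w' := w - ∑ a, s a • z a with hw'
  have huw' : f u w' ≠ 0 := by
    rw [hw', map_sub, map_sum]
    simpa [hu'] using hw
  obtain ⟨e, he⟩ := exists_add_star_eq_one hs
  -- With `u` and `w'` isotropic, this coefficient gives the vector the value `e + star e = 1`.
  have h1 := hcon ((e / f u w') • u + w') fun b => by simp [hu', hsw]
  have h2 := hcon u hu'
  have h3 := hcon w' hsw
  have h4 : f w' u = star (f u w') := hsymm _ _
  simp only [map_add, map_smul, LinearMap.add_apply, LinearMap.smul_apply, map_smulₛₗ, hσ, h2,
    h3, h4, smul_eq_mul, mul_zero, zero_add, add_zero] at h1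
  rw [← star_mul', div_mul_cancel₀ _ huw'] at h1
  exact one_ne_zero (he.symm.trans (by linear_combination h1))

/-- Unit vectors are adjoined one at a time, which keeps the Gram matrix non-degenerate. When `d =
0` the family is already a basis, which gives the completeness clause. -/
theorem GramNondegenerate.exists_orthonormal_extension {q : ℕ}
    (hK : Fintype.card K = q ^ 2) (hs : ∃ x : K, star x ≠ x) (hσ : ∀ x, σ x = star x)
    (hsymm : ∀ v w, f v w = star (f w v)) (hnd : ∀ v, (∀ w, f v w = 0) → v = 0) (d : ℕ)
    {ζ : Type*} [Fintype ζ] {z : ζ → V} (hz : GramNondegenerate f z)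
    (hd : Fintype.card ζ + d = finrank K V) :
    ∃ w : Fin d → V, (∀ k b, f (w k) (z b) = 0) ∧
      (∀ k l, f (w k) (w l) = if k = l then 1 else 0) ∧
      ∀ v, (∀ b, f v (z b) = 0) → (∀ k, f v (w k) = 0) → v = 0 := by
  induction d generalizing ζ with
  | zero =>
    refine ⟨Fin.elim0, fun k => k.elim0, fun k => k.elim0, fun v hv _ => ?_⟩
    have hspan := hz.linearIndependent.span_eq_top_of_card_eq_finrank' (by simpa using hd)
    obtain ⟨c, rfl⟩ := (Submodule.mem_span_range_iff_exists_fun K).1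
      (hspan.symm ▸ Submodule.mem_top : v ∈ Submodule.span K (Set.range z))
    have hc := hz c fun b => by
      simpa only [map_sum, map_smul, LinearMap.sum_apply, LinearMap.smul_apply, smul_eq_mul]
        using hv b
    simp [hc]
  | succ d ih =>
    obtain ⟨v, hv, hvv⟩ := hz.exists_unit_orthogonal hK hs hσ hsymm hnd (by omega)
    have hv' : ∀ b, f (z b) v = 0 := fun b => by rw [hsymm, hv, star_zero]
    have hz' : GramNondegenerate f (fun o : Option ζ => o.elim v z) := by
      intro c hc
      have h0 := hc none
      have h1 : ∀ b, _ := fun b => hc (some b)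
      simp only [Fintype.sum_option, Option.elim_none, Option.elim_some, hv', hvv, hv, mul_zero,
        Finset.sum_const_zero, mul_one, add_zero, zero_add] at h0 h1
      have h2 := hz _ h1
      ext o
      cases o with
      | none => exact h0
      | some a => exact congrFun h2 a
    obtain ⟨w, hw1, hw2, hw3⟩ := ih hz' (by rw [Fintype.card_option]; omega)
    refine ⟨Fin.cons v w, ?_, ?_, ?_⟩
    · intro k b
      refine Fin.cases ?_ (fun k => ?_) k
      · exact hv b
      · exact hw1 k (some b)
    · intro k l
      refine Fin.cases ?_ (fun k => ?_) k <;> refine Fin.cases ?_ (fun l => ?_) l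
      · simpa using hvv
      · rw [hsymm]
        simpa [(Fin.succ_ne_zero l).symm] using hw1 l none
      · simpa using hw1 k none
      · simpa using hw2 k l
    · intro x hx1 hx2
      refine hw3 x (fun o => ?_) fun k => ?_
      · cases o with
        | none => exact hx2 0
        | some b => exact hx1 b
      · exact hx2 k.succ

end Orthonormal

/-! ### Sums over hermitian extensions of a block. -/

section MatrixSums

variable {K : Type*} [Field K] [Fintype K] [StarRing K]
  {J : Type*} [Fintype J] {J' : Type*} [Fintype J']
  {ι : Type*} [Fintype ι] {κ : Type*} [Fintype κ] {κ' : Type*} [Fintype κ']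

/-- The sum of `g` over the hermitian matrices with principal submatrix `H` along `ε`. -/
noncomputable def extSum (g : Matrix J J K → ℚ) (ε : κ → J) (H : Matrix κ κ K) : ℚ :=
  ∑ B : Matrix J J K with B.IsHermitian ∧ B.submatrix ε ε = H, g B

/-- The sum of `g` over all translates of `B` by the matrices `x xᴴ`. -/
noncomputable def rankOneSum (g : Matrix J J K → ℚ) (B : Matrix J J K) : ℚ :=
  ∑ x : J → K, g (B + vecMulVec x (star x))

/-- Invariance under congruence `B ↦ P B Pᴴ`. -/
def CongrInvariant (g : Matrix J J K → ℚ) : Prop :=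
  ∀ P B : Matrix J J K, Function.Injective P.mulVec → g (P * B * Pᴴ) = g B

omit [Fintype K] in
theorem CongrInvariant.apply_of_isUnit [DecidableEq J] {g : Matrix J J K → ℚ}
    (hg : CongrInvariant g) {P : Matrix J J K} (hP : IsUnit P) (B : Matrix J J K) :
    g (P * B * Pᴴ) = g B :=
  hg P B (mulVec_injective_iff_isUnit.2 hP)

omit [Fintype K] [Fintype J] in
theorem mul_rankOne_mul_conjTranspose (P : Matrix J κ' K) (x : κ' → K) :
    P * vecMulVec x (star x) * Pᴴ = vecMulVec (P *ᵥ x) (star (P *ᵥ x)) := by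
  rw [mul_vecMulVec, vecMulVec_mul, star_mulVec]

theorem CongrInvariant.rankOneSum {g : Matrix J J K → ℚ} (hg : CongrInvariant g) :
    CongrInvariant (rankOneSum g) := by
  intro P B hP
  unfold HermitianAnzahl.rankOneSum
  have hbij : Function.Bijective (fun x : J → K => P *ᵥ x) :=
    ⟨hP, mulVec_surjective_iff_isUnit.2 (mulVec_injective_iff_isUnit.1 hP)⟩
  rw [← hbij.sum_comp]
  refine Finset.sum_congr rfl fun x _ => ?_
  rw [← mul_rankOne_mul_conjTranspose, ← add_mul, ← mul_add, hg _ _ hP]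

theorem extSum_reindex (g : Matrix J J K → ℚ) (e : J' ≃ J) (ε : κ → J') (H : Matrix κ κ K) :
    extSum g (e ∘ ε) H = extSum (fun B => g (B.submatrix e.symm e.symm)) ε H := by
  unfold extSum
  refine Finset.sum_nbij' (fun B => B.submatrix e e) (fun B => B.submatrix e.symm e.symm) ?_ ?_ ?_
    ?_ ?_
  · intro B hB
    simp only [mem_filter, mem_univ, true_and] at hB ⊢
    exact ⟨hB.1.submatrix e, hB.2⟩
  · intro B hB
    simp only [mem_filter, mem_univ, true_and] at hB ⊢
    refine ⟨hB.1.submatrix e.symm, ?_⟩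
    rw [← hB.2]; ext a b; simp
  · intro B _; ext a b; simp
  · intro B _; ext a b; simp
  · intro B _; congr 1; ext a b; simp

theorem extSum_comp_equiv (g : Matrix J J K → ℚ) (ε : κ → J) (e : κ' ≃ κ) (H : Matrix κ κ K) :
    extSum g (ε ∘ e) (H.submatrix e e) = extSum g ε H := by
  unfold extSum
  refine Finset.sum_congr ?_ fun _ _ => rfl
  ext B
  simp only [mem_filter, mem_univ, true_and, and_congr_right_iff]
  intro _
  constructor
  · intro h
    ext a b
    simpa using congrFun (congrFun h (e.symm a)) (e.symm b)
  · rintro rfl; rfl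

omit [Fintype K] in
theorem CongrInvariant.comp_submatrix {g : Matrix J J K → ℚ}
    (hg : CongrInvariant g) (e : J' ≃ J) :
    CongrInvariant (fun B : Matrix J' J' K => g (B.submatrix e.symm e.symm)) := by
  intro P B hP
  have hP' : IsUnit (P.submatrix e.symm e.symm) :=
    (isUnit_submatrix_equiv e.symm e.symm).2 (mulVec_injective_iff_isUnit.1 hP)
  have := hg.apply_of_isUnit hP' (B.submatrix e.symm e.symm)
  rw [conjTranspose_submatrix, submatrix_mul_equiv, submatrix_mul_equiv] at this
  exact this

omit [Fintype K] in
theorem congr_congr_cancel [DecidableEq κ] {A C : Matrix κ κ K} (h : A * C = 1)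
    (B : Matrix κ κ K) : A * (C * B * Cᴴ) * Aᴴ = B := by
  rw [show A * (C * B * Cᴴ) * Aᴴ = (A * C) * B * (A * C)ᴴ by
    rw [conjTranspose_mul]; simp only [Matrix.mul_assoc]]
  simp [h]

theorem exists_sum_equiv {J κ : Type*} {ε : κ → J} (hε : Function.Injective ε) :
    ∃ e : {j // j ∉ Set.range ε} ⊕ κ ≃ J, e ∘ Sum.inr = ε := by
  refine ⟨(Equiv.sumComm _ _).trans ((Equiv.sumCongr (Equiv.ofInjective ε hε) (Equiv.refl _)).trans
    (Equiv.sumCompl (· ∈ Set.range ε))), ?_⟩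
  ext k
  simp

/-- Congruence by `diag(1, P)` carries the extensions of `H` bijectively to those of `P H Pᴴ`. -/
theorem CongrInvariant.extSum_inr {g : Matrix (ι ⊕ κ) (ι ⊕ κ) K → ℚ} (hg : CongrInvariant g) :
    CongrInvariant (extSum g (Sum.inr : κ → ι ⊕ κ)) := by
  intro P H hP
  obtain ⟨u, rfl⟩ := mulVec_injective_iff_isUnit.1 hP
  set P := (u : Matrix κ κ K)
  set R := ((u⁻¹ : (Matrix κ κ K)ˣ) : Matrix κ κ K)
  have hPR : P * R = 1 := u.mul_inv
  have hRP : R * P = 1 := u.inv_mul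
  let P' : Matrix (ι ⊕ κ) (ι ⊕ κ) K := fromBlocks 1 0 0 P
  let R' : Matrix (ι ⊕ κ) (ι ⊕ κ) K := fromBlocks 1 0 0 R
  have hPR' : P' * R' = 1 := by simp [P', R', fromBlocks_multiply, hPR]
  have hRP' : R' * P' = 1 := by simp [P', R', fromBlocks_multiply, hRP]
  have hconj : ∀ (A : Matrix κ κ K) (B : Matrix (ι ⊕ κ) (ι ⊕ κ) K),
      ((fromBlocks 1 0 0 A : Matrix (ι ⊕ κ) (ι ⊕ κ) K) * B *
        (fromBlocks 1 0 0 A)ᴴ).submatrix Sum.inr Sum.inr =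
      A * B.submatrix Sum.inr Sum.inr * Aᴴ := by
    intro A B
    obtain ⟨a, b, c, d, rfl⟩ : ∃ a b c d, B = fromBlocks a b c d :=
      ⟨_, _, _, _, (fromBlocks_toBlocks B).symm⟩
    simp only [fromBlocks_conjTranspose, fromBlocks_multiply]
    have hsub : ∀ (a : Matrix ι ι K) (b : Matrix ι κ K) (c : Matrix κ ι K) (d : Matrix κ κ K),
      (fromBlocks a b c d).submatrix Sum.inr Sum.inr = d := fun _ _ _ _ => rfl
    rw [hsub, hsub]
    simp
  unfold extSum
  refine Finset.sum_nbij' (fun B => R' * B * R'ᴴ) (fun B => P' * B * P'ᴴ) ?_ ?_ ?_ ?_ ?_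
  · intro B hB
    simp only [mem_filter, mem_univ, true_and] at hB ⊢
    refine ⟨isHermitian_mul_mul_conjTranspose _ hB.1, ?_⟩
    rw [hconj, hB.2]
    exact congr_congr_cancel hRP _
  · intro B hB
    simp only [mem_filter, mem_univ, true_and] at hB ⊢
    refine ⟨isHermitian_mul_mul_conjTranspose _ hB.1, ?_⟩
    rw [hconj, hB.2]
  · intro B _; exact congr_congr_cancel hPR' _
  · intro B _; exact congr_congr_cancel hRP' _
  · intro B _
    exact (hg.apply_of_isUnit (IsUnit.of_mul_eq_one _ hRP') B).symm

theorem CongrInvariant.extSum {g : Matrix J J K → ℚ} (hg : CongrInvariant g) {ε : κ → J}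
    (hε : Function.Injective ε) : CongrInvariant (extSum g ε) := by
  obtain ⟨e, he⟩ := exists_sum_equiv hε
  have h := (hg.comp_submatrix e).extSum_inr
  intro P H hP
  rw [← he, extSum_reindex, extSum_reindex]
  exact h P H hP

theorem extSum_extSum (g : Matrix J J K → ℚ) (ε : κ → J) (δ : κ' → κ) (H : Matrix κ' κ' K) :
    extSum (extSum g ε) δ H = extSum g (ε ∘ δ) H := by
  unfold extSum
  rw [← Finset.sum_fiberwise_of_maps_to
    (s := {B : Matrix J J K | B.IsHermitian ∧ B.submatrix (ε ∘ δ) (ε ∘ δ) = H})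
    (t := {A : Matrix κ κ K | A.IsHermitian ∧ A.submatrix δ δ = H}) (g := fun B => B.submatrix ε ε)]
  · refine Finset.sum_congr rfl fun A hA => Finset.sum_congr ?_ fun _ _ => rfl
    simp only [mem_filter, mem_univ, true_and] at hA
    ext B
    simp only [mem_filter, mem_univ, true_and]
    constructor
    · rintro ⟨h1, rfl⟩
      exact ⟨⟨h1, hA.2⟩, rfl⟩
    · rintro ⟨⟨h1, _⟩, rfl⟩
      exact ⟨h1, rfl⟩
  · intro B hB
    simp only [mem_filter, mem_univ, true_and] at hB ⊢
    exact ⟨hB.1.submatrix ε, hB.2⟩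

theorem extSum_translate (g : Matrix J J K → ℚ) (ε : κ → J) (H : Matrix κ κ K) {S : Matrix J J K}
    (hS : S.IsHermitian) :
    extSum (fun B => g (B + S)) ε H = extSum g ε (H + S.submatrix ε ε) := by
  unfold extSum
  refine Finset.sum_nbij' (fun B => B + S) (fun B => B - S) ?_ ?_ ?_ ?_ ?_
  · intro B hB
    simp only [mem_filter, mem_univ, true_and] at hB ⊢
    exact ⟨hB.1.add hS, by rw [← hB.2]; rfl⟩
  · intro B hB
    simp only [mem_filter, mem_univ, true_and] at hB ⊢
    refine ⟨hB.1.sub hS, ?_⟩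
    rw [submatrix_sub, Pi.sub_apply, Pi.sub_apply, hB.2, add_sub_cancel_right]
  · intro B _; simp
  · intro B _; simp
  · intro B _; rfl

/-- The Schur complement parametrisation of the hermitian extensions of an identity block. -/
theorem CongrInvariant.extSum_inr_one [DecidableEq ι] [DecidableEq κ] {h : Matrix (ι ⊕ κ) (ι ⊕ κ) K → ℚ}
    (hh : CongrInvariant h) {q : ℕ} (hK : Fintype.card K = q ^ 2) :
    HermitianAnzahl.extSum h (Sum.inr : κ → ι ⊕ κ) 1 =
      (q : ℚ) ^ (2 * Fintype.card ι * Fintype.card κ) *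
        ∑ X : Matrix ι ι K with X.IsHermitian, h (fromBlocks X 0 0 1) := by
  -- Unipotent congruences clear the off-diagonal block, leaving the Schur complement `X`; the block
  -- `Y` is free and contributes only the power of `q`.
  let P : Matrix ι κ K → Matrix (ι ⊕ κ) (ι ⊕ κ) K := fun Y => fromBlocks 1 Y 0 1
  have hP : ∀ Y, IsUnit (P Y) := by
    intro Y
    refine IsUnit.of_mul_eq_one (P (-Y)) ?_
    simp [P, fromBlocks_multiply]
  have hform : ∀ (X : Matrix ι ι K) (Y : Matrix ι κ K),
      P Y * fromBlocks X 0 0 1 * (P Y)ᴴ = fromBlocks (X + Y * Yᴴ) Y Yᴴ 1 := by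
    intro X Y
    simp [P, fromBlocks_multiply, fromBlocks_conjTranspose]
  have key : HermitianAnzahl.extSum h (Sum.inr : κ → ι ⊕ κ) 1 =
      ∑ p ∈ ({X : Matrix ι ι K | X.IsHermitian} : Finset _) ×ˢ (univ : Finset (Matrix ι κ K)),
        h (P p.2 * fromBlocks p.1 0 0 1 * (P p.2)ᴴ) := by
    unfold HermitianAnzahl.extSum
    refine Finset.sum_nbij' (fun B => (B.toBlocks₁₁ - B.toBlocks₁₂ * B.toBlocks₁₂ᴴ, B.toBlocks₁₂))
      (fun p => fromBlocks (p.1 + p.2 * p.2ᴴ) p.2 p.2ᴴ 1) ?_ ?_ ?_ ?_ ?_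
    · intro B hB
      simp only [mem_filter, mem_univ, true_and, mem_product, and_true] at hB ⊢
      exact IsHermitian.sub (hB.1.submatrix Sum.inl) (isHermitian_mul_conjTranspose_self _)
    · rintro ⟨X, Y⟩ hX
      simp only [mem_filter, mem_univ, true_and, mem_product, and_true] at hX ⊢
      constructor
      · rw [isHermitian_fromBlocks_iff]
        exact ⟨hX.add (isHermitian_mul_conjTranspose_self _), rfl, by simp, isHermitian_one⟩
      · ext a b; simp [submatrix_apply]
    · intro B hB
      simp only [mem_filter, mem_univ, true_and] at hB
      conv_rhs => rw [← fromBlocks_toBlocks B]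
      have h2 : B.toBlocks₂₁ = B.toBlocks₁₂ᴴ := by
        ext a b
        exact (hB.1.apply _ _).symm
      rw [h2, sub_add_cancel]
      congr 1
      exact hB.2.symm
    · rintro ⟨X, Y⟩ _
      simp
    · intro B hB
      simp only [mem_filter, mem_univ, true_and] at hB
      dsimp only
      rw [hform, sub_add_cancel]
      conv_lhs => rw [← fromBlocks_toBlocks B]
      have h2 : B.toBlocks₂₁ = B.toBlocks₁₂ᴴ := by
        ext a b
        exact (hB.1.apply _ _).symm
      rw [h2]
      congr 2
      exact hB.2
  rw [key, Finset.sum_product]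
  simp only [hh.apply_of_isUnit (hP _), Finset.sum_const, nsmul_eq_mul, ← Finset.mul_sum, Finset.card_univ]
  congr 1
  rw [show Fintype.card (Matrix ι κ K) = Fintype.card (ι → κ → K) from rfl, Fintype.card_fun,
    Fintype.card_fun, hK]
  push_cast
  ring

/-- Translating by `x xᴴ` changes the block to `H + y yᴴ` with `y = x ∘ ε`, and every `y` comes from
equally many `x`. The powers of `q` stand on both sides to avoid subtracting cardinalities. -/
theorem extSum_rankOneSum [DecidableEq κ] (g : Matrix J J K → ℚ) {ε : κ → J} (hε : Function.Injective ε)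
    (H : Matrix κ κ K) {q : ℕ} (hK : Fintype.card K = q ^ 2) :
    extSum (rankOneSum g) ε H * (q : ℚ) ^ (2 * Fintype.card κ) =
      (q : ℚ) ^ (2 * Fintype.card J) * ∑ y : κ → K, extSum g ε (H + vecMulVec y (star y)) := by
  have h1 : extSum (rankOneSum g) ε H =
      ∑ x : J → K, extSum g ε (H + vecMulVec (x ∘ ε) (star (x ∘ ε))) := by
    have h2 : ∀ x : J → K, extSum g ε (H + vecMulVec (x ∘ ε) (star (x ∘ ε))) =
        extSum (fun B => g (B + vecMulVec x (star x))) ε H := by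
      intro x
      rw [extSum_translate]
      · rfl
      · ext a b
        simp [vecMulVec_apply, mul_comm]
    simp only [h2]
    unfold extSum rankOneSum
    exact Finset.sum_comm
  let φ : (J → K) →+ (κ → K) :=
    { toFun := fun x => x ∘ ε, map_zero' := rfl, map_add' := fun _ _ => rfl }
  have hφ : Function.Surjective φ := hε.surjective_comp_right
  have h3 := sum_comp_addMonoidHom φ hφ fun y => extSum g ε (H + vecMulVec y (star y))
  rw [h1]
  rw [Fintype.card_fun, Fintype.card_fun, hK, ← pow_mul, ← pow_mul] at h3
  push_cast at h3
  exact h3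

end MatrixSums

/-! ### Congruence classes of `1` and of its rank-one translates. -/

section Congruence

variable {K : Type*} [Field K] [StarRing K]
  {J : Type*} [Fintype J] {κ : Type*} [Fintype κ]

/-- The sesquilinear form `x H yᴴ` on row vectors. -/
noncomputable def sesqForm (H : Matrix κ κ K) : (κ → K) →ₗ[K] (κ → K) →ₛₗ[starRingEnd K] K :=
  LinearMap.mk₂'ₛₗ (RingHom.id K) (starRingEnd K) (fun x y => x ⬝ᵥ H *ᵥ star y)
    (fun x x' y => add_dotProduct _ _ _)
    (fun c x y => smul_dotProduct _ _ _)
    (fun x y y' => by rw [star_add, mulVec_add, dotProduct_add])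
    (fun c x y => by
      rw [star_smul, mulVec_smul, dotProduct_smul]; rfl)

theorem sesqForm_apply (H : Matrix κ κ K) (x y : κ → K) :
    sesqForm H x y = x ⬝ᵥ H *ᵥ star y := rfl

theorem sesqForm_symm {H : Matrix κ κ K} (hH : H.IsHermitian) (x y : κ → K) :
    sesqForm H x y = star (sesqForm H y x) := by
  rw [sesqForm_apply, sesqForm_apply, dotProduct_mulVec, dotProduct_star, star_vecMul, hH.eq]

theorem sesqForm_nondegenerate [DecidableEq κ] {H : Matrix κ κ K} (hH : IsUnit H) (x : κ → K)
    (hx : ∀ y, sesqForm H x y = 0) : x = 0 := by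
  have h1 : x ᵥ* H = 0 := by
    ext k
    have := hx (star (Pi.single k 1))
    rw [sesqForm_apply, star_star, dotProduct_mulVec] at this
    simpa using this
  exact vecMul_injective_iff_isUnit.2 hH (by simpa using h1)

theorem mul_mul_conjTranspose_apply (P H : Matrix κ κ K) (a b : κ) :
    (P * H * Pᴴ) a b = sesqForm H (P a) (P b) := by
  rw [sesqForm_apply, dotProduct_mulVec]
  rfl

variable [Fintype K] {q : ℕ}

theorem exists_congr_one [DecidableEq κ] (hK : Fintype.card K = q ^ 2)
    (hs : ∃ x : K, star x ≠ x) {H : Matrix κ κ K} (hH : H.IsHermitian) (hu : IsUnit H) :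
    ∃ P : Matrix κ κ K, IsUnit P ∧ P * H * Pᴴ = 1 := by
  have hz : GramNondegenerate (sesqForm H) (Empty.elim : Empty → κ → K) :=
    fun c _ => Subsingleton.elim _ _
  obtain ⟨w, -, hw, -⟩ := hz.exists_orthonormal_extension hK hs (fun _ => rfl) (sesqForm_symm hH)
    (sesqForm_nondegenerate hu) (Fintype.card κ) (by simp)
  let P : Matrix κ κ K := fun a => w (Fintype.equivFin κ a)
  have hP : P * H * Pᴴ = 1 := by
    ext a b
    rw [mul_mul_conjTranspose_apply, hw, one_apply]
    simp
  refine ⟨P, ?_, hP⟩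
  rw [Matrix.mul_assoc] at hP
  exact IsUnit.of_mul_eq_one _ hP

theorem exists_unitary_first_row [DecidableEq κ] (hK : Fintype.card K = q ^ 2)
    (hs : ∃ x : K, star x ≠ x) (z : Unit ⊕ κ → K) (hz : z ⬝ᵥ star z = 1) :
    ∃ P : Matrix (Unit ⊕ κ) (Unit ⊕ κ) K, P * Pᴴ = 1 ∧ P (Sum.inl ()) = z := by
  have hnd : GramNondegenerate (sesqForm (1 : Matrix (Unit ⊕ κ) (Unit ⊕ κ) K))
      (fun _ : Unit => z) := by
    intro c hc
    have h0 := hc ()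
    simp only [sesqForm_apply, one_mulVec, hz, mul_one, Fintype.sum_unique] at h0
    ext u; exact h0
  obtain ⟨w, hw1, hw2, -⟩ := hnd.exists_orthonormal_extension hK hs (fun _ => rfl)
    (sesqForm_symm isHermitian_one) (sesqForm_nondegenerate isUnit_one) (Fintype.card κ)
    (by simp)
  have hw3 : ∀ k, sesqForm (1 : Matrix (Unit ⊕ κ) (Unit ⊕ κ) K) z (w k) = 0 := fun k => by
    rw [sesqForm_symm isHermitian_one, hw1 k (), star_zero]
  let P : Matrix (Unit ⊕ κ) (Unit ⊕ κ) K := Sum.elim (fun _ => z) (fun a => w (Fintype.equivFin κ a))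
  refine ⟨P, ?_, rfl⟩
  rw [show P * Pᴴ = P * 1 * Pᴴ by rw [Matrix.mul_one]]
  ext a b
  rw [mul_mul_conjTranspose_apply, one_apply]
  rcases a with a | a <;> rcases b with b | b
  · simpa [P, sesqForm_apply] using hz
  · simpa [P] using hw3 _
  · simpa [P] using hw1 _ ()
  · simp [P, hw2]

theorem CongrInvariant.apply_eq_one [DecidableEq J] {g : Matrix J J K → ℚ} (hg : CongrInvariant g)
    (hK : Fintype.card K = q ^ 2) (hs : ∃ x : K, star x ≠ x) {H : Matrix J J K}
    (hH : H.IsHermitian) (hu : IsUnit H) : g H = g 1 := by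
  obtain ⟨P, hP, h⟩ := exists_congr_one hK hs hH hu
  rw [← h, hg.apply_of_isUnit hP]

/-- Since `det (1 + y yᴴ) = 1 + yᴴ y`, the matrix is invertible, hence congruent to `1`, unless `yᴴ
y = -1`. In that case a unitary matrix moves `y` to a multiple of the first unit vector, and the
first diagonal entry becomes `0`. -/
theorem CongrInvariant.apply_one_add_rankOne [DecidableEq κ]
    {g : Matrix (Unit ⊕ κ) (Unit ⊕ κ) K → ℚ} (hg : CongrInvariant g)
    (hK : Fintype.card K = q ^ 2) (hs : ∃ x : K, star x ≠ x) (y : Unit ⊕ κ → K) :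
    g (1 + vecMulVec y (star y)) =
      if star y ⬝ᵥ y = -1 then g (fromBlocks 0 0 0 1) else g 1 := by
  split_ifs with h
  · obtain ⟨l, hl⟩ := exists_norm_eq hK hs (t := (-1 : K)) (by simp)
    set z := l • star y with hzdef
    have hz : z ⬝ᵥ star z = 1 := by
      rw [hzdef, star_smul, star_star, smul_dotProduct, dotProduct_smul, h, smul_smul]
      simp [hl]
    obtain ⟨P, hP, hPz⟩ := exists_unitary_first_row hK hs z hz
    have hl0 : l ≠ 0 := by rintro rfl; simp at hl
    have hPy : P *ᵥ y = Sum.elim (fun _ => -l) 0 := by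
      have hyz : y = (star l)⁻¹ • star z := by
        rw [hzdef, star_smul, star_star, smul_smul, inv_mul_cancel₀ (by simpa using hl0), one_smul]
      ext a
      have hPa := congrFun (congrFun hP a) (Sum.inl ())
      have h2 : (P *ᵥ y) a = (star l)⁻¹ * (P * Pᴴ) a (Sum.inl ()) := by
        conv_lhs => rw [hyz, mulVec_smul]
        rw [Pi.smul_apply, smul_eq_mul]
        congr 1
        rw [← hPz]; rfl
      rw [h2, hPa, one_apply]
      rcases a with a | a
      · have hsl : star l ≠ 0 := by simpa using hl0
        simp only [Sum.elim_inl, if_true]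
        field_simp
        linear_combination hl
      · simp
    rw [← hg.apply_of_isUnit (IsUnit.of_mul_eq_one _ hP), Matrix.mul_add, Matrix.add_mul,
      mul_rankOne_mul_conjTranspose, Matrix.mul_one, hP, hPy]
    congr 1
    ext a b
    rcases a with a | a <;> rcases b with b | b <;> simp [vecMulVec_apply, one_apply, hl]
  · refine hg.apply_eq_one hK hs ?_ ?_
    · refine isHermitian_one.add ?_
      ext a b
      simp [vecMulVec_apply, mul_comm]
    · rw [isUnit_iff_isUnit_det, vecMulVec_eq Unit, det_one_add_replicateCol_mul_replicateRow,
        isUnit_iff_ne_zero]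
      intro h0
      exact h (by linear_combination h0)

/-- Splitting off one coordinate gives `N_(m+1) = (q + 1) q^(2m) - q N_m`: that coordinate has `q +
1` values, but only one when the others already have norm `c`. -/
theorem card_star_dotProduct_eq_fin (hK : Fintype.card K = q ^ 2) (hs : ∃ x : K, star x ≠ x) (m : ℕ) {c : K}
    (hc : star c = c) (hc0 : c ≠ 0) :
    (#{y : Fin m → K | star y ⬝ᵥ y = c} : ℚ) * q = q ^ m * (q ^ m - (-1) ^ m) := by
  induction m with
  | zero => simp [hc0.symm]
  | succ m ih =>
    have h1 : #{y : Fin (m + 1) → K | star y ⬝ᵥ y = c} =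
        ∑ y : Fin m → K, #{x : K | x * star x = c - star y ⬝ᵥ y} := by
      rw [← Finset.card_sigma]
      refine Finset.card_nbij' (fun y => ⟨Fin.tail y, y 0⟩) (fun p => Fin.cons p.2 p.1) ?_ ?_ ?_ ?_
      · intro y hy
        simp only [mem_coe, mem_filter, mem_univ, true_and, mem_sigma] at hy ⊢
        rw [← hy]
        simp [dotProduct, Fin.sum_univ_succ, Fin.tail, mul_comm]
      · rintro ⟨y, x⟩ hy
        simp only [mem_coe, mem_filter, mem_univ, true_and, mem_sigma] at hy ⊢
        simp only [dotProduct, Fin.sum_univ_succ, Pi.star_apply, Fin.cons_zero, Fin.cons_succ] at hy ⊢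
        rw [mul_comm, hy]; ring
      · intro y _; simp
      · rintro ⟨y, x⟩ _; simp
    have h2 : ∀ y : Fin m → K, (#{x : K | x * star x = c - star y ⬝ᵥ y} : ℚ) =
        (q + 1) - if star y ⬝ᵥ y = c then (q : ℚ) else 0 := by
      intro y
      split_ifs with hy
      · rw [hy, sub_self]
        have : ({x : K | x * star x = 0} : Finset K) = {0} := by ext x; simp
        rw [this]; simp
      · rw [card_norm_eq hK hs]
        · simp
        · rw [star_sub, hc, ← star_dotProduct]
        · exact sub_ne_zero.2 (Ne.symm hy)
    rw [h1]
    push_cast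
    simp only [h2]
    rw [Finset.sum_sub_distrib, ← Finset.sum_filter, Finset.sum_const, Finset.sum_const,
      Finset.card_univ, Fintype.card_fun, hK]
    simp only [nsmul_eq_mul, Fintype.card_fin]
    push_cast
    linear_combination (-(q : ℚ)) * ih

theorem card_star_dotProduct_eq [DecidableEq κ] (hK : Fintype.card K = q ^ 2) (hs : ∃ x : K, star x ≠ x) {c : K}
    (hc : star c = c) (hc0 : c ≠ 0) :
    (#{y : κ → K | star y ⬝ᵥ y = c} : ℚ) * q =
      q ^ Fintype.card κ * (q ^ Fintype.card κ - (-1) ^ Fintype.card κ) := by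
  rw [← card_star_dotProduct_eq_fin hK hs (Fintype.card κ) hc hc0]
  congr 2
  let e := Fintype.equivFin κ
  refine Finset.card_bij' (fun y _ => y ∘ e.symm) (fun y _ => y ∘ e) ?_ ?_ ?_ ?_
  · intro y hy
    simp only [mem_filter, mem_univ, true_and] at hy ⊢
    rw [← hy]
    exact e.symm.sum_comp (fun a => star (y a) * y a)
  · intro y hy
    simp only [mem_filter, mem_univ, true_and] at hy ⊢
    rw [← hy]
    exact e.sum_comp (fun a => star (y a) * y a)
  · intro y _; ext a; simp
  · intro y _; ext a; simp

end Congruence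

/-! ### The recursion for rank-one translates. -/

section Counts

variable {K : Type*} [Field K] [Fintype K] [StarRing K]
  {J : Type*} [Fintype J] {κ : Type*} [Fintype κ] {ι : Type*} [Fintype ι] {q : ℕ}

/-- The map `C ↦ C + Cᴴ` has the skew-hermitian matrices, a scalar multiple of the hermitian ones,
as kernel, and all hermitian matrices as image. So the square of the count is the number of all
matrices. -/
theorem card_isHermitian [DecidableEq J] (hK : Fintype.card K = q ^ 2) (hs : ∃ x : K, star x ≠ x) :
    #{X : Matrix J J K | X.IsHermitian} = q ^ (Fintype.card J) ^ 2 := by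
  obtain ⟨e, he⟩ := exists_add_star_eq_one hs
  obtain ⟨x, hx⟩ := hs
  have hη : x - star x ≠ 0 := sub_ne_zero.2 (Ne.symm hx)
  have hη' : star (x - star x) = -(x - star x) := by rw [star_sub, star_star, neg_sub]
  set η := x - star x
  let D : Matrix J J K →+ Matrix J J K :=
    { toFun := fun C => C + Cᴴ
      map_zero' := by simp
      map_add' := fun C C' => by rw [conjTranspose_add]; abel }
  have hD : ∀ C, D C = C + Cᴴ := fun _ => rfl
  have h1 : Nat.card D.ker = #{X : Matrix J J K | X.IsHermitian} := by
    rw [Nat.card_eq_fintype_card, Fintype.card_subtype]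
    refine Finset.card_bij' (fun C _ => η⁻¹ • C) (fun X _ => η • X) ?_ ?_ ?_ ?_
    · intro C hC
      simp only [mem_filter, mem_univ, true_and, AddMonoidHom.mem_ker, hD] at hC ⊢
      rw [Matrix.IsHermitian, conjTranspose_smul, star_inv₀, hη', eq_neg_of_add_eq_zero_right hC, inv_neg,
        neg_smul_neg]
    · intro X hX
      simp only [mem_filter, mem_univ, true_and, AddMonoidHom.mem_ker, hD] at hX ⊢
      rw [conjTranspose_smul, hη', hX.eq, neg_smul, add_neg_cancel]
    · intro C _; rw [smul_smul, mul_inv_cancel₀ hη, one_smul]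
    · intro C _; rw [smul_smul, inv_mul_cancel₀ hη, one_smul]
  have h2 : Nat.card D.range = #{X : Matrix J J K | X.IsHermitian} := by
    rw [Nat.card_eq_fintype_card, Fintype.card_subtype]
    congr 1
    ext X
    simp only [mem_filter, mem_univ, true_and, AddMonoidHom.mem_range]
    constructor
    · rintro ⟨C, rfl⟩
      exact isHermitian_add_transpose_self C
    · intro hX
      refine ⟨e • X, ?_⟩
      rw [hD, conjTranspose_smul, hX.eq, ← add_smul, he, one_smul]
  have h3 := AddSubgroup.card_mul_index D.ker
  rw [AddSubgroup.index_ker, h1, h2, Nat.card_eq_fintype_card,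
    show Fintype.card (Matrix J J K) = Fintype.card (J → J → K) from rfl, Fintype.card_fun,
    Fintype.card_fun, hK] at h3
  apply Nat.mul_self_inj.1
  rw [h3]
  ring

/-- Passing through the intermediate block of size `|κ| + 1`, the Schur complement is one of `q`
fixed scalars. The `q - 1` nonzero ones give the class of `1`, and zero gives `diag(0, 1)`. -/
theorem CongrInvariant.extSum_comp_inr [DecidableEq κ] {g : Matrix J J K → ℚ}
    (hg : CongrInvariant g) (hK : Fintype.card K = q ^ 2) (hs : ∃ x : K, star x ≠ x)
    {ε : Unit ⊕ κ → J} (hε : Function.Injective ε) :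
    HermitianAnzahl.extSum g (ε ∘ Sum.inr) 1 = (q : ℚ) ^ (2 * Fintype.card κ) *
      ((q - 1) * HermitianAnzahl.extSum g ε 1 +
        HermitianAnzahl.extSum g ε (fromBlocks 0 0 0 1)) := by
  have hE := hg.extSum hε
  rw [← extSum_extSum, hE.extSum_inr_one hK]
  simp only [Fintype.card_unit, mul_one]
  congr 1
  have hval : ∀ X : Matrix Unit Unit K, X ∈ ({X | X.IsHermitian} : Finset (Matrix Unit Unit K)) →
      HermitianAnzahl.extSum g ε (fromBlocks X 0 0 1) =
        HermitianAnzahl.extSum g ε 1 + if X = 0 then HermitianAnzahl.extSum g ε (fromBlocks 0 0 0 1) -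
          HermitianAnzahl.extSum g ε 1 else 0 := by
    intro X hX
    simp only [mem_filter, mem_univ, true_and] at hX
    split_ifs with h
    · rw [h]; ring
    · rw [add_zero]
      refine hE.apply_eq_one hK hs ?_ ?_
      · rw [isHermitian_fromBlocks_iff]
        exact ⟨hX, by simp, by simp, isHermitian_one⟩
      · rw [isUnit_iff_isUnit_det, det_fromBlocks_zero₂₁, det_one, mul_one, det_unique,
          isUnit_iff_ne_zero]
        intro h0
        apply h
        ext a b
        exact h0
  rw [Finset.sum_congr rfl hval, Finset.sum_add_distrib, Finset.sum_const, card_isHermitian hK hs,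
    Finset.sum_ite_eq' _ (0 : Matrix Unit Unit K)]
  simp only [mem_filter, mem_univ, isHermitian_zero, and_self, if_true, Fintype.card_unit, one_pow,
    pow_one, nsmul_eq_mul]
  ring

/-- The recursion for the sum of `rankOneSum g` over the hermitian extensions of an identity
block. -/
theorem CongrInvariant.extSum_rankOneSum [DecidableEq κ] {g : Matrix J J K → ℚ}
    (hg : CongrInvariant g) (hK : Fintype.card K = q ^ 2) (hs : ∃ x : K, star x ≠ x) (hq : q ≠ 0)
    {ε : Unit ⊕ κ → J} (hε : Function.Injective ε) {m : ℕ} (hm : Fintype.card κ = m) :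
    HermitianAnzahl.extSum (HermitianAnzahl.rankOneSum g) ε 1 = (q : ℚ) ^ (2 * Fintype.card J) *
      (((-q : ℚ)⁻¹) ^ (m + 1) * HermitianAnzahl.extSum g ε 1 +
        (1 - ((-q : ℚ)⁻¹) ^ (m + 1)) * ((q : ℚ) ^ (2 * m + 1))⁻¹ *
          HermitianAnzahl.extSum g (ε ∘ Sum.inr) 1) := by
  have hE := hg.extSum hε
  have hq' : (q : ℚ) ≠ 0 := by exact_mod_cast hq
  have h1 := HermitianAnzahl.extSum_rankOneSum g hε 1 hK
  -- This relation eliminates the value at the singular block `diag(0, 1)` in favour of the smaller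
  -- identity block.
  have h2 := hg.extSum_comp_inr hK hs hε
  have h3 := card_star_dotProduct_eq (κ := Unit ⊕ κ) hK hs (c := (-1 : K)) (by simp) (by simp)
  have hval : ∀ y : Unit ⊕ κ → K, HermitianAnzahl.extSum g ε (1 + vecMulVec y (star y)) =
      HermitianAnzahl.extSum g ε 1 + if star y ⬝ᵥ y = -1 then
        HermitianAnzahl.extSum g ε (fromBlocks 0 0 0 1) - HermitianAnzahl.extSum g ε 1 else 0 := by
    intro y
    rw [hE.apply_one_add_rankOne hK hs]
    split_ifs <;> ring
  simp only [hval] at h1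
  rw [Finset.sum_add_distrib, ← Finset.sum_filter, Finset.sum_const, Finset.sum_const,
    Finset.card_univ, Fintype.card_fun, hK] at h1
  simp only [Fintype.card_sum, Fintype.card_unit, nsmul_eq_mul, hm] at h1 h2 h3
  push_cast at h1
  rw [h2]
  generalize HermitianAnzahl.extSum g ε 1 = a at *
  generalize HermitianAnzahl.extSum g ε (fromBlocks 0 0 0 1) = s at *
  generalize (#{y : Unit ⊕ κ → K | star y ⬝ᵥ y = -1} : ℚ) = N at *
  have hN : N = (q : ℚ) ^ (1 + m) * (q ^ (1 + m) - (-1) ^ (1 + m)) / q := by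
    rw [← h3, mul_div_assoc, div_self hq', mul_one]
  have hinv : ((-q : ℚ)⁻¹) ^ (m + 1) = (-1) ^ (m + 1) / q ^ (m + 1) := by
    rw [inv_pow, neg_pow, mul_inv, ← inv_pow, inv_neg_one, div_eq_mul_inv]
  rw [← mul_left_inj' (pow_ne_zero (2 * (1 + m)) hq'), h1, hN, hinv]
  field_simp
  ring

end Counts

/-! ### Counting invertible hermitian matrices. -/

section Nonsingular

/-- The indicator function of the invertible matrices. -/
noncomputable def nonsingInd {K J : Type*} [Field K] [Fintype J] (B : Matrix J J K) : ℚ :=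
  if Function.Injective B.mulVec then 1 else 0

variable {K : Type*} [Field K] [Fintype K] [StarRing K]
  {J : Type*} [Fintype J] {J' : Type*} [Fintype J'] {κ : Type*} [Fintype κ] {ι : Type*} [Fintype ι]
  {q : ℕ}

omit [StarRing K] in
theorem nonsingInd_eq [DecidableEq J] (B : Matrix J J K) :
    nonsingInd B = if IsUnit B then 1 else 0 := by
  unfold nonsingInd
  simp only [mulVec_injective_iff_isUnit]

theorem congrInvariant_nonsingInd : CongrInvariant (nonsingInd : Matrix J J K → ℚ) := by
  intro P B hP
  rw [mulVec_injective_iff_isUnit] at hP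
  rw [nonsingInd_eq, nonsingInd_eq]
  have hP' : IsUnit Pᴴ := (isUnit_conjTranspose P).2 hP
  obtain ⟨u, rfl⟩ := hP
  obtain ⟨v, hv⟩ := hP'
  rw [← hv]
  simp

omit [Fintype K] in
theorem congrInvariant_const (c : ℚ) : CongrInvariant (fun _ : Matrix J J K => c) :=
  fun _ _ _ => rfl

omit [StarRing K] in
theorem nonsingInd_submatrix_equiv (e : J' ≃ J) (B : Matrix J J K) :
    nonsingInd (B.submatrix e e) = nonsingInd B := by
  simp only [nonsingInd_eq, isUnit_submatrix_equiv]

omit [StarRing K] in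
theorem nonsingInd_fromBlocks_one [DecidableEq κ] (X : Matrix ι ι K) :
    nonsingInd (fromBlocks X 0 0 (1 : Matrix κ κ K)) = nonsingInd X := by
  simp only [nonsingInd_eq, isUnit_iff_isUnit_det, det_fromBlocks_zero₂₁, det_one, mul_one]

theorem extSum_nonsingInd_inr [DecidableEq κ] [DecidableEq ι] (hK : Fintype.card K = q ^ 2) :
    extSum (nonsingInd : Matrix (ι ⊕ κ) (ι ⊕ κ) K → ℚ) Sum.inr 1 =
      (q : ℚ) ^ (2 * Fintype.card ι * Fintype.card κ) *
        ∑ X : Matrix ι ι K with X.IsHermitian, nonsingInd X := by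
  rw [congrInvariant_nonsingInd.extSum_inr_one hK]
  simp only [nonsingInd_fromBlocks_one]

/-- This counts hermitian matrices with a vanishing block. Translating by `diag(0, 1)` makes the
block the identity, where the Schur complement parametrisation applies. -/
theorem extSum_one_inr [DecidableEq κ] [DecidableEq ι] (hK : Fintype.card K = q ^ 2)
    (hs : ∃ x : K, star x ≠ x) :
    extSum (fun _ : Matrix (ι ⊕ κ) (ι ⊕ κ) K => 1) (Sum.inr : κ → ι ⊕ κ) 0 =
      (q : ℚ) ^ (2 * Fintype.card ι * Fintype.card κ + (Fintype.card ι) ^ 2) := by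
  have hS : (fromBlocks 0 0 0 1 : Matrix (ι ⊕ κ) (ι ⊕ κ) K).IsHermitian := by
    rw [isHermitian_fromBlocks_iff]
    exact ⟨isHermitian_zero, by simp, by simp, isHermitian_one⟩
  have h := extSum_translate (fun _ : Matrix (ι ⊕ κ) (ι ⊕ κ) K => 1) Sum.inr 0 hS
  rw [h, show (0 : Matrix κ κ K) + (fromBlocks 0 0 0 1 : Matrix (ι ⊕ κ) (ι ⊕ κ) K).submatrix
    Sum.inr Sum.inr = 1 by ext a b; simp, (congrInvariant_const 1).extSum_inr_one hK,
    Finset.sum_const, card_isHermitian hK hs, pow_add]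
  simp

theorem extSum_nonsingInd [DecidableEq J] [DecidableEq κ] (hK : Fintype.card K = q ^ 2) {ε : κ → J}
    (hε : Function.Injective ε) :
    extSum (nonsingInd : Matrix J J K → ℚ) ε 1 =
      (q : ℚ) ^ (2 * Fintype.card {j // j ∉ Set.range ε} * Fintype.card κ) *
        ∑ X : Matrix {j // j ∉ Set.range ε} {j // j ∉ Set.range ε} K with X.IsHermitian,
          nonsingInd X := by
  obtain ⟨e, he⟩ := exists_sum_equiv hε
  rw [← extSum_nonsingInd_inr hK]
  conv_lhs => rw [← he, extSum_reindex]
  simp only [nonsingInd_submatrix_equiv]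

theorem sum_isHermitian_congr [DecidableEq J] (h : Matrix J J K → ℚ) {P : Matrix J J K}
    (hP : IsUnit P) :
    ∑ B : Matrix J J K with B.IsHermitian, h (P * B * Pᴴ) =
      ∑ B : Matrix J J K with B.IsHermitian, h B := by
  obtain ⟨u, rfl⟩ := hP
  refine Finset.sum_nbij' (fun B => u * B * (u : Matrix J J K)ᴴ)
    (fun B => (u⁻¹ : (Matrix J J K)ˣ) * B * ((u⁻¹ : (Matrix J J K)ˣ) : Matrix J J K)ᴴ)
    ?_ ?_ ?_ ?_ ?_
  · intro B hB
    simp only [mem_filter, mem_univ, true_and] at hB ⊢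
    exact isHermitian_mul_mul_conjTranspose _ hB
  · intro B hB
    simp only [mem_filter, mem_univ, true_and] at hB ⊢
    exact isHermitian_mul_mul_conjTranspose _ hB
  · intro B _; exact congr_congr_cancel u.inv_mul B
  · intro B _; exact congr_congr_cancel u.mul_inv B
  · intro B _; rfl

theorem card_sesqForm_eq_one [DecidableEq J] (hK : Fintype.card K = q ^ 2)
    (hs : ∃ x : K, star x ≠ x) {B : Matrix J J K} (hB : B.IsHermitian) (hu : IsUnit B) :
    (#{v : J → K | sesqForm B v v = 1} : ℚ) * q =
      q ^ Fintype.card J * (q ^ Fintype.card J - (-1) ^ Fintype.card J) := by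
  have hinv : CongrInvariant (fun B : Matrix J J K => (#{v : J → K | sesqForm B v v = 1} : ℚ)) := by
    intro P B hP
    rw [mulVec_injective_iff_isUnit] at hP
    dsimp only
    congr 1
    refine Finset.card_bij (fun v _ => v ᵥ* P) ?_ ?_ ?_
    · intro v hv
      simp only [mem_filter, mem_univ, true_and] at hv ⊢
      rw [← hv, sesqForm_apply, sesqForm_apply, star_vecMul, dotProduct_mulVec, dotProduct_mulVec,
        dotProduct_mulVec, vecMul_vecMul, vecMul_vecMul, Matrix.mul_assoc]
    · intro v _ w _ h
      exact vecMul_injective_iff_isUnit.2 hP h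
    · intro w hw
      obtain ⟨v, rfl⟩ := vecMul_surjective_iff_isUnit.2 hP w
      refine ⟨v, ?_, rfl⟩
      simp only [mem_filter, mem_univ, true_and] at hw ⊢
      rw [← hw, sesqForm_apply, sesqForm_apply, star_vecMul, dotProduct_mulVec, dotProduct_mulVec,
        dotProduct_mulVec, vecMul_vecMul, vecMul_vecMul, Matrix.mul_assoc]
  have h1 := hinv.apply_eq_one hK hs hB hu
  rw [h1, ← card_star_dotProduct_eq hK hs (star_one K) one_ne_zero]
  simp only [sesqForm_apply, one_mulVec, dotProduct_comm]

/-- Double counting of pairs of an invertible hermitian matrix and a vector of norm `1`. -/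
theorem sum_nonsingInd_succ [DecidableEq J] (hK : Fintype.card K = q ^ 2)
    (hs : ∃ x : K, star x ≠ x) (c : ℚ)
    (hc : ∀ k : J, ∑ X : Matrix {j // j ∉ Set.range fun _ : Unit => k}
      {j // j ∉ Set.range fun _ : Unit => k} K with X.IsHermitian, nonsingInd X = c) {m : ℕ}
    (hm : Fintype.card J = m + 1) :
    (∑ B : Matrix J J K with B.IsHermitian, nonsingInd B) *
      (q ^ (m + 1) * (q ^ (m + 1) - (-1) ^ (m + 1))) =
      ((q : ℚ) ^ (2 * (m + 1)) - 1) * q ^ (2 * m) * c * q := by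
  have hrow : ∀ v : J → K, (∑ B : Matrix J J K with B.IsHermitian,
      nonsingInd B * if sesqForm B v v = 1 then (1 : ℚ) else 0) =
      if v = 0 then 0 else (q : ℚ) ^ (2 * m) * c := by
    intro v
    split_ifs with hv
    · simp [hv]
    · obtain ⟨k, hk⟩ := Function.ne_iff.1 hv
      -- Putting `v` in row `k` of the identity gives determinant `v k ≠ 0`. Congruence by this
      -- matrix turns the condition on `v` into `B k k = 1`, an extension of a `1 × 1` identity
      -- block.
      have hu : IsUnit ((1 : Matrix J J K).updateRow k v) := by
        rw [isUnit_iff_isUnit_det, ← det_transpose, ← updateCol_transpose, transpose_one,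
          ← cramer_apply, cramer_one]
        simpa using hk
      have h1 := sum_isHermitian_congr
        (fun B => nonsingInd B * if B k k = 1 then (1 : ℚ) else 0) hu
      simp only [congrInvariant_nonsingInd.apply_of_isUnit hu, mul_mul_conjTranspose_apply,
        updateRow_self] at h1
      rw [h1]
      have h2 := extSum_nonsingInd (K := K) hK (ε := fun _ : Unit => k)
        (Function.injective_of_subsingleton _)
      have hcard : Fintype.card {j // j ∉ Set.range fun _ : Unit => k} = m := by
        rw [Fintype.card_subtype_compl, hm]
        simp
      rw [hc, hcard, Fintype.card_unit, mul_one] at h2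
      rw [← h2]
      unfold extSum
      simp only [mul_ite, mul_one, mul_zero]
      rw [← Finset.sum_filter, Finset.filter_filter]
      refine Finset.sum_congr ?_ fun _ _ => rfl
      ext B
      simp only [mem_filter, mem_univ, true_and, and_congr_right_iff]
      intro _
      constructor
      · intro h; ext a b; simpa using h
      · intro h; simpa using congrFun (congrFun h ()) ()
  have hcol : ∀ B ∈ ({B : Matrix J J K | B.IsHermitian} : Finset _),
      (∑ v : J → K, nonsingInd B * if sesqForm B v v = 1 then (1 : ℚ) else 0) * q =
        nonsingInd B * (q ^ (m + 1) * (q ^ (m + 1) - (-1) ^ (m + 1))) := by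
    intro B hB
    simp only [mem_filter, mem_univ, true_and] at hB
    rw [← Finset.mul_sum, nonsingInd_eq]
    split_ifs with hu
    · rw [← hm, ← card_sesqForm_eq_one hK hs hB hu]
      simp
    · simp
  rw [Finset.sum_mul, ← Finset.sum_congr rfl hcol, ← Finset.sum_mul, Finset.sum_comm]
  simp only [hrow]
  congr 1
  rw [Finset.sum_ite, Finset.sum_const_zero, zero_add, Finset.sum_const, nsmul_eq_mul,
    Finset.filter_ne' univ (0 : J → K), Finset.cast_card_erase_of_mem (mem_univ _), Finset.card_univ,
    Fintype.card_fun, hK, hm]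
  push_cast
  ring

/-- With `ε = (-1)^(m+1)`, the double count cancels `q^(m+1) - ε` from `q^(2(m+1)) - 1`, so each
step contributes the factor `q^(2m+1) (1 + (-q)^(-(m+1)))`. -/
theorem sum_nonsingInd [DecidableEq J] (hK : Fintype.card K = q ^ 2)
    (hs : ∃ x : K, star x ≠ x) (hq : 2 ≤ q) {m : ℕ} (hm : Fintype.card J = m) :
    ∑ B : Matrix J J K with B.IsHermitian, nonsingInd B =
      (q : ℚ) ^ (m ^ 2) * ∏ l ∈ Finset.range m, (1 + ((-q : ℚ)⁻¹) ^ (l + 1)) := by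
  induction m generalizing J with
  | zero =>
    have : IsEmpty J := Fintype.card_eq_zero_iff.1 hm
    rw [Finset.sum_eq_single (1 : Matrix J J K)]
    · simp [nonsingInd_eq]
    · intro B _ hB
      exact absurd (Subsingleton.elim _ _) hB
    · simp [isHermitian_one]
  | succ m ih =>
    have hq' : (q : ℚ) ≠ 0 := by positivity
    have h := sum_nonsingInd_succ (J := J) hK hs _ (fun k => ih (by
      rw [Fintype.card_subtype_compl, hm]; simp)) hm
    have hne : (q : ℚ) ^ (m + 1) - (-1) ^ (m + 1) ≠ 0 := by
      have h1 : (2 : ℚ) ≤ q := by exact_mod_cast hq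
      have h2 : (2 : ℚ) ≤ q ^ (m + 1) := h1.trans (le_self_pow₀ (by linarith) (by omega))
      rcases neg_one_pow_eq_or ℚ (m + 1) with h3 | h3 <;> rw [h3] <;> linarith
    rw [← mul_left_inj' (mul_ne_zero (pow_ne_zero (m + 1) hq') hne), h, Finset.prod_range_succ]
    have hs1 : ((-1 : ℚ) ^ (m + 1)) ^ 2 = 1 := by rw [← pow_mul, mul_comm, pow_mul]; simp
    have hinv : ((-q : ℚ)⁻¹) ^ (m + 1) = (-1) ^ (m + 1) / q ^ (m + 1) := by
      rw [inv_pow, neg_pow, mul_inv, ← inv_pow, inv_neg_one, div_eq_mul_inv]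
    rw [hinv]
    generalize ∏ l ∈ Finset.range m, (1 + ((-q : ℚ)⁻¹) ^ (l + 1)) = p
    have h4 : (1 + (-1) ^ (m + 1) / (q : ℚ) ^ (m + 1)) * (q ^ (m + 1) *
        (q ^ (m + 1) - (-1) ^ (m + 1))) = q ^ (2 * (m + 1)) - 1 := by
      rw [← mul_assoc, add_mul, one_mul, div_mul_cancel₀ _ (pow_ne_zero _ hq')]
      linear_combination -hs1
    linear_combination (-(q : ℚ) ^ ((m + 1) ^ 2) * p) * h4

end Nonsingular

/-! ### The closed form and its recursion. -/

section ClosedForm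

/-- The Gaussian binomial coefficient `[m, s]_Q`. -/
noncomputable def gaussBinom (Q : ℚ) (m s : ℕ) : ℚ :=
  ∏ k ∈ Finset.range s, (Q ^ (m - k) - 1) / (Q ^ (k + 1) - 1)

/-- The product `∏_{l=1}^{k} (1 + R^l)`. -/
def onePlusProd (R : ℚ) (k : ℕ) : ℚ := ∏ l ∈ Finset.range k, (1 + R ^ (l + 1))

/-- The `q`-hypergeometric sum that governs the number of non-singular complements. -/
noncomputable def complementSum (Q : ℚ) (j m d : ℕ) : ℚ :=
  ∑ s ∈ Finset.range (m + 1), (-1) ^ s * onePlusProd Q⁻¹ (j - s) * Q⁻¹ ^ (s * (j + 1 - s)) *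
    Q⁻¹ ^ (d * s) * gaussBinom Q m s

variable {Q : ℚ}

theorem gaussBinom_zero_right (m : ℕ) : gaussBinom Q m 0 = 1 := by simp [gaussBinom]

theorem gaussBinom_succ_right (m s : ℕ) :
    gaussBinom Q m (s + 1) = gaussBinom Q m s * ((Q ^ (m - s) - 1) / (Q ^ (s + 1) - 1)) :=
  Finset.prod_range_succ _ _

/-- The last numerator is `Q^0 - 1`. This lets sums for `m` and `m + 1` share a range. -/
theorem gaussBinom_self_succ (m : ℕ) : gaussBinom Q m (m + 1) = 0 := by
  simp [gaussBinom_succ_right]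

theorem gaussBinom_succ_left_mul (hQ1 : ∀ k, Q ^ (k + 1) ≠ 1) {m s : ℕ} (hs : s ≤ m + 1) :
    gaussBinom Q (m + 1) s * (Q ^ (m + 1 - s) - 1) = (Q ^ (m + 1) - 1) * gaussBinom Q m s := by
  induction s with
  | zero => simp [gaussBinom_zero_right]
  | succ s ih =>
    have h1 := ih (by omega)
    rw [gaussBinom_succ_right, gaussBinom_succ_right, show m + 1 - (s + 1) = m - s by omega]
    have h2 : Q ^ (s + 1) - 1 ≠ 0 := sub_ne_zero.2 (hQ1 s)
    field_simp
    linear_combination (Q ^ (m - s) - 1) * h1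

theorem gaussBinom_succ_succ (hQ1 : ∀ k, Q ^ (k + 1) ≠ 1) {m s : ℕ} (hs : s ≤ m) :
    gaussBinom Q (m + 1) (s + 1) =
      gaussBinom Q m (s + 1) + Q ^ (m - s) * gaussBinom Q m s := by
  have h1 := gaussBinom_succ_left_mul hQ1 (show s ≤ m + 1 by omega)
  rw [gaussBinom_succ_right, gaussBinom_succ_right]
  have h2 : Q ^ (s + 1) - 1 ≠ 0 := sub_ne_zero.2 (hQ1 s)
  have h3 : Q ^ (m + 1) = Q ^ (m - s) * Q ^ (s + 1) := by rw [← pow_add]; congr 1; omega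
  field_simp
  rw [h3] at h1
  linear_combination h1

theorem complementSum_zero_left (j d : ℕ) : complementSum Q j 0 d = onePlusProd Q⁻¹ j := by
  simp [complementSum, gaussBinom_zero_right]

theorem inv_pow_mul_pow (hQ : Q ≠ 0) {a b c : ℕ} (h : a = b + c) : Q⁻¹ ^ a * Q ^ b = Q⁻¹ ^ c := by
  rw [h, pow_add, mul_right_comm, ← mul_pow, inv_mul_cancel₀ hQ, one_pow, one_mul]

/-- Raising `d` multiplies the term of index `s` by `Q^(-s)`, and `Q^(-s) [m+1, s] = Q^(-(m+1))
[m+1, s] + (1 - Q^(-(m+1))) [m, s]`; the recursion holds term by term. -/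
theorem complementSum_succ_succ (hQ : Q ≠ 0) (hQ1 : ∀ k, Q ^ (k + 1) ≠ 1) (j m d : ℕ) :
    complementSum Q j (m + 1) (d + 1) = Q⁻¹ ^ (m + 1) * complementSum Q j (m + 1) d +
      (1 - Q⁻¹ ^ (m + 1)) * complementSum Q j m d := by
  have hext : complementSum Q j m d = ∑ s ∈ Finset.range (m + 2), (-1) ^ s *
      onePlusProd Q⁻¹ (j - s) * Q⁻¹ ^ (s * (j + 1 - s)) * Q⁻¹ ^ (d * s) * gaussBinom Q m s := by
    rw [Finset.sum_range_succ, gaussBinom_self_succ, mul_zero, add_zero]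
    rfl
  rw [hext]
  unfold complementSum
  rw [Finset.mul_sum, Finset.mul_sum, ← Finset.sum_add_distrib]
  refine Finset.sum_congr rfl fun s hs => ?_
  have hs' : s ≤ m + 1 := by have := Finset.mem_range.1 hs; omega
  have h1 := gaussBinom_succ_left_mul hQ1 hs'
  have h2 : Q⁻¹ ^ (m + 1) * Q ^ (m + 1) = 1 := by rw [← mul_pow, inv_mul_cancel₀ hQ, one_pow]
  have h3 : Q⁻¹ ^ (m + 1) * Q ^ (m + 1 - s) = Q⁻¹ ^ s := inv_pow_mul_pow hQ (by omega)
  rw [add_mul d 1 s, one_mul, pow_add]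
  have h4 : gaussBinom Q (m + 1) s * Q⁻¹ ^ s = Q⁻¹ ^ (m + 1) * gaussBinom Q (m + 1) s +
      (1 - Q⁻¹ ^ (m + 1)) * gaussBinom Q m s := by
    linear_combination Q⁻¹ ^ (m + 1) * h1 - gaussBinom Q (m + 1) s * h3 + gaussBinom Q m s * h2
  linear_combination ((-1) ^ s * onePlusProd Q⁻¹ (j - s) * Q⁻¹ ^ (s * (j + 1 - s)) *
    Q⁻¹ ^ (d * s)) * h4

/-- With `S` the sum at `d = 0`, Pascal's rule gives `S(j+1, m+1) = S(j+1, m) - Q^(-(j+1-m)) S(j,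
m)`. The product satisfies the same relation, by splitting off its last factor. -/
theorem complementSum_zero_right (hQ : Q ≠ 0) (hQ1 : ∀ k, Q ^ (k + 1) ≠ 1) {j m : ℕ}
    (hm : m ≤ j) : complementSum Q j m 0 = onePlusProd Q⁻¹ (j - m) := by
  induction m generalizing j with
  | zero => rw [complementSum_zero_left, Nat.sub_zero]
  | succ m ih =>
    obtain ⟨j, rfl⟩ : ∃ j', j = j' + 1 := ⟨j - 1, by omega⟩
    have h1 := ih (show m ≤ j + 1 by omega)
    have h2 := ih (show m ≤ j by omega)
    have key : complementSum Q (j + 1) (m + 1) 0 =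
        complementSum Q (j + 1) m 0 - Q⁻¹ ^ (j + 1 - m) * complementSum Q j m 0 := by
      have hext : complementSum Q (j + 1) m 0 = ∑ s ∈ Finset.range (m + 2), (-1) ^ s *
          onePlusProd Q⁻¹ (j + 1 - s) * Q⁻¹ ^ (s * (j + 1 + 1 - s)) * Q⁻¹ ^ (0 * s) *
            gaussBinom Q m s := by
        rw [Finset.sum_range_succ, gaussBinom_self_succ, mul_zero, add_zero]
        rfl
      rw [hext]
      unfold complementSum
      rw [Finset.sum_range_succ', Finset.sum_range_succ' _ (m + 1), Finset.mul_sum,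
        add_sub_right_comm, ← Finset.sum_sub_distrib]
      congr 1
      · refine Finset.sum_congr rfl fun s hs => ?_
        have hs' : s ≤ m := by have := Finset.mem_range.1 hs; omega
        rw [gaussBinom_succ_succ hQ1 hs', show j + 1 - (s + 1) = j - s by omega,
          show j + 1 + 1 - (s + 1) = j + 1 - s by omega, add_mul s 1, one_mul, pow_add,
          pow_succ (-1 : ℚ)]
        have h3 : Q⁻¹ ^ (j + 1 - s) * Q ^ (m - s) = Q⁻¹ ^ (j + 1 - m) :=
          inv_pow_mul_pow hQ (by omega)
        simp only [zero_mul, pow_zero, mul_one]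
        linear_combination (-(-1) ^ s * onePlusProd Q⁻¹ (j - s) * Q⁻¹ ^ (s * (j + 1 - s)) *
          gaussBinom Q m s) * h3
    rw [key, h1, h2, show j + 1 - m = j - m + 1 by omega, show j + 1 - (m + 1) = j - m by omega]
    unfold onePlusProd
    rw [Finset.prod_range_succ]
    ring

theorem neg_pow_succ_ne_one {q : ℕ} (hq : 2 ≤ q) (k : ℕ) : (-q : ℚ) ^ (k + 1) ≠ 1 := by
  intro h
  have h1 : (2 : ℚ) ≤ q := by exact_mod_cast hq
  have h2 : (2 : ℚ) ≤ q ^ (k + 1) := h1.trans (le_self_pow₀ (by linarith) (by omega))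
  rw [neg_pow] at h
  rcases neg_one_pow_eq_or ℚ (k + 1) with h3 | h3 <;> rw [h3] at h <;> linarith

end ClosedForm

/-! ### Evaluation of the iterated extension sum. -/

section ExtensionSum

variable {K : Type*} [Field K] [Fintype K] [StarRing K] {J : Type*} [Fintype J] {q : ℕ}

/-- There are `q^(j² - m²)` extensions and `q^(2jd)` choices of translates, so `complementSum` is
the proportion of invertible outcomes. Both sides satisfy the same recursion in `d`. -/
theorem extSum_iterate_nonsingInd [DecidableEq J] (hK : Fintype.card K = q ^ 2)
    (hs : ∃ x : K, star x ≠ x) (hq : 2 ≤ q) {j : ℕ} (hJ : Fintype.card J = j) (d m : ℕ)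
    {ε : Fin m → J} (hε : Function.Injective ε) :
    extSum (rankOneSum^[d] (nonsingInd : Matrix J J K → ℚ)) ε 1 * (q : ℚ) ^ (m ^ 2) =
      (q : ℚ) ^ (2 * j * d + j ^ 2) * complementSum (-q) j m d := by
  have hq0 : (q : ℚ) ≠ 0 := by positivity
  have hQ : (-q : ℚ) ≠ 0 := neg_ne_zero.2 hq0
  have hQ1 := neg_pow_succ_ne_one hq
  have hmj : m ≤ j := by
    have := Fintype.card_le_of_injective ε hε
    simpa [hJ] using this
  have hinv : ∀ d, CongrInvariant (rankOneSum^[d] (nonsingInd : Matrix J J K → ℚ)) := by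
    intro d
    induction d with
    | zero => exact congrInvariant_nonsingInd
    | succ d ih => rw [Function.iterate_succ_apply']; exact ih.rankOneSum
  induction d generalizing m with
  | zero =>
    have hcard : Fintype.card {a // a ∉ Set.range ε} = j - m := by
      rw [Fintype.card_subtype_compl, hJ]
      congr 1
      rw [show Fintype.card {x // x ∈ Set.range ε} = Fintype.card (Set.range ε) from rfl,
        Set.card_range_of_injective hε, Fintype.card_fin]
    rw [Function.iterate_zero, id, extSum_nonsingInd hK hε, hcard,
      sum_nonsingInd hK hs hq hcard, complementSum_zero_right hQ hQ1 hmj, Fintype.card_fin]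
    obtain ⟨i, rfl⟩ := Nat.exists_eq_add_of_le hmj
    rw [Nat.add_sub_cancel_left]
    unfold onePlusProd
    ring
  | succ d ih =>
    rw [Function.iterate_succ_apply']
    cases m with
    | zero =>
      -- An empty block imposes no condition, so a further translate only multiplies the sum by
      -- `q^(2j)`.
      have h1 := ih 0 hε hmj
      have h2 := extSum_rankOneSum (rankOneSum^[d] (nonsingInd : Matrix J J K → ℚ)) hε 1 hK
      simp only [Fintype.card_fin, mul_zero, pow_zero, mul_one, Fintype.sum_unique] at h2
      rw [h2, complementSum_zero_left, mul_assoc]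
      rw [Subsingleton.elim (1 + vecMulVec (default : Fin 0 → K) (star default)) 1, h1,
        complementSum_zero_left, hJ]
      ring
    | succ m =>
      let e : Unit ⊕ Fin m ≃ Fin (m + 1) :=
        Fintype.equivOfCardEq (by simp [add_comm])
      have he : Function.Injective (ε ∘ e) := hε.comp e.injective
      have h1 := ih (m + 1) hε hmj
      have h2 := ih m (he.comp Sum.inr_injective) (by omega)
      have h3 := (hinv d).extSum_rankOneSum hK hs (by omega) he (Fintype.card_fin m)
      have h4 : ∀ g : Matrix J J K → ℚ, extSum g (ε ∘ e) 1 = extSum g ε 1 := by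
        intro g
        rw [← extSum_comp_equiv g ε e 1, submatrix_one_equiv]
      rw [h4, h4] at h3
      rw [h3, complementSum_succ_succ hQ hQ1, hJ]
      generalize extSum (rankOneSum^[d] (nonsingInd : Matrix J J K → ℚ)) ε 1 = a at *
      generalize extSum (rankOneSum^[d] (nonsingInd : Matrix J J K → ℚ))
        ((ε ∘ e) ∘ Sum.inr) 1 = b at *
      generalize complementSum (-q : ℚ) j (m + 1) d = A at *
      generalize complementSum (-q : ℚ) j m d = B at *
      generalize ((-q : ℚ)⁻¹) ^ (m + 1) = r
      have h5 : ((q : ℚ) ^ (2 * m + 1))⁻¹ * q ^ ((m + 1) ^ 2) = q ^ (m ^ 2) := by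
        rw [inv_mul_eq_iff_eq_mul₀ (pow_ne_zero _ hq0), ← pow_add]
        congr 1; ring
      have h6 : (q : ℚ) ^ (2 * j * (d + 1) + j ^ 2) = q ^ (2 * j) * q ^ (2 * j * d + j ^ 2) := by
        rw [← pow_add]; congr 1; ring
      rw [h6]
      linear_combination (q : ℚ) ^ (2 * j) * r * h1 + (q : ℚ) ^ (2 * j) * (1 - r) * h2 +
        (q : ℚ) ^ (2 * j) * (1 - r) * b * h5

end ExtensionSum

/-! ### Translation from powers of `-q` to the stated formula. -/

section Formula

theorem phiPlus_one_eq {q : ℕ} (hq : 2 ≤ q) (k : ℕ) :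
    phiPlus 1 k q = (q : ℚ) ^ ((k + 1).choose 2) * onePlusProd (-q : ℚ)⁻¹ k := by
  have hq0 : (q : ℚ) ≠ 0 := by positivity
  unfold phiPlus onePlusProd
  induction k with
  | zero => simp
  | succ k ih =>
    have hinv : ((-q : ℚ)⁻¹) ^ (k + 1) = (-1) ^ (k + 1) / q ^ (k + 1) := by
      rw [inv_pow, neg_pow, mul_inv, ← inv_pow, inv_neg_one, div_eq_mul_inv]
    rw [Finset.prod_Icc_succ_top (by omega), ih, Finset.prod_range_succ,
      Nat.choose_succ_succ' (k + 1) 1, Nat.choose_one_right, hinv]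
    generalize ∏ l ∈ Finset.range k, (1 + ((-q : ℚ)⁻¹) ^ (l + 1)) = p
    field_simp
    ring

theorem phiPlus_mul_phiPlus (x : ℚ) {i k : ℕ} (h : i ≤ k) :
    phiPlus 1 i x * phiPlus (i + 1) k x = phiPlus 1 k x := by
  unfold phiPlus
  induction k, h using Nat.le_induction with
  | base => simp
  | succ k hk ih =>
    rw [Finset.prod_Icc_succ_top (by omega), Finset.prod_Icc_succ_top (by omega), ← mul_assoc, ih]

/-- Each factor satisfies `q^k - (-1)^k = (-1)^k ((-q)^k - 1)`. Every one of the `s` quotients then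
carries the sign `(-1)^(b-k) / (-1)^(k+1) = (-1)^(b+1)`. -/
theorem gaussMinus_eq {q : ℕ} {b s : ℕ} (h : s ≤ b) :
    gaussMinus b s q = (-1) ^ (s * (b + 1)) * gaussBinom (-q : ℚ) b s := by
  have hpm : ∀ k : ℕ, (q : ℚ) ^ k - (-1) ^ k = (-1) ^ k * ((-q : ℚ) ^ k - 1) := by
    intro k
    have h1 : ((-1 : ℚ) ^ k) * (-1) ^ k = 1 := by rw [← mul_pow]; simp
    rw [neg_pow (q : ℚ)]
    linear_combination (-(q : ℚ) ^ k) * h1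
  have h1 : phiMinus 1 s q = ∏ k ∈ Finset.range s, ((q : ℚ) ^ (k + 1) - (-1) ^ (k + 1)) := by
    unfold phiMinus
    rw [Finset.range_eq_Ico, Finset.prod_Ico_add' (fun k => (q : ℚ) ^ k - (-1) ^ k) 0 s 1]
    rfl
  have h2 : phiMinus (b - s + 1) b q =
      ∏ k ∈ Finset.range s, ((q : ℚ) ^ (b - k) - (-1) ^ (b - k)) := by
    unfold phiMinus
    rw [← Finset.prod_range_reflect]
    refine (Finset.prod_bij (fun k _ => b - s + 1 + k) ?_ ?_ ?_ ?_).symm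
    · intro k hk
      have := Finset.mem_range.1 hk
      rw [Finset.mem_Icc]; omega
    · intro k _ l _ hkl; omega
    · intro k hk
      rw [Finset.mem_Icc] at hk
      exact ⟨k - (b - s + 1), Finset.mem_range.2 (by omega), by omega⟩
    · intro k hk
      have := Finset.mem_range.1 hk
      rw [show b - (s - 1 - k) = b - s + 1 + k by omega]
  rw [gaussMinus, if_pos h, h1, h2, ← Finset.prod_div_distrib, gaussBinom, mul_comm s, pow_mul,
    ← Finset.card_range s, ← Finset.prod_const, Finset.card_range, ← Finset.prod_mul_distrib]
  refine Finset.prod_congr rfl fun k hk => ?_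
  have hk' := Finset.mem_range.1 hk
  rw [hpm, hpm, mul_div_mul_comm]
  congr 1
  rw [div_eq_iff (pow_ne_zero _ (by norm_num)), ← pow_add]
  rw [show b + 1 + (k + 1) = (b - k) + 2 * (k + 1) by omega, pow_add, pow_mul]
  norm_num

theorem choose_two_add (k s : ℕ) :
    (k + s + 1).choose 2 = (k + 1).choose 2 + s.choose 2 + s * (k + 1) := by
  induction s with
  | zero => simp
  | succ s ih =>
    rw [show k + (s + 1) + 1 = (k + s + 1) + 1 by ring, Nat.choose_succ_succ' (k + s + 1) 1,
      Nat.choose_succ_succ' s 1, ih, Nat.choose_one_right, Nat.choose_one_right]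
    ring

theorem complementSum_eq_formula {q : ℕ} (hq : 2 ≤ q) {i j n d : ℕ} (hij : i ≤ j)
    (hn : n = j + i + d) :
    (q : ℚ) ^ (2 * j * (i + d)) * complementSum (-q) j (j - i) d =
      (q : ℚ) ^ (2 * (j : ℤ) * ((n : ℤ) - (j : ℤ)) - ((j + 1).choose 2 : ℤ)) *
        phiPlus 1 i q *
        ∑ m ∈ Finset.range (j - i + 1),
          (-1 : ℚ) ^ (m * (n - j)) * phiPlus (i + 1) (j - m) q * gaussMinus (j - i) m q *
            (q : ℚ) ^ ((m.choose 2 : ℤ) - (m : ℤ) * ((n : ℤ) - (j : ℤ) - (i : ℤ))) := by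
  have hq0 : (q : ℚ) ≠ 0 := by positivity
  unfold complementSum
  rw [Finset.mul_sum, Finset.mul_sum]
  refine Finset.sum_congr rfl fun s hs => ?_
  have hs' : s ≤ j - i := by have := Finset.mem_range.1 hs; omega
  obtain ⟨k, rfl⟩ : ∃ k, j = k + s := ⟨j - s, by omega⟩
  rw [gaussMinus_eq hs', show n - (k + s) = i + d by omega, Nat.add_sub_cancel,
    show k + s + 1 - s = k + 1 by omega]
  have h1 := phiPlus_mul_phiPlus (q : ℚ) (show i ≤ k by omega)
  rw [phiPlus_one_eq hq k] at h1
  have hexp : (q : ℚ) ^ (2 * ((k + s : ℕ) : ℤ) * ((n : ℤ) - ((k + s : ℕ) : ℤ)) -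
      ((k + s + 1).choose 2 : ℤ)) *
      (q : ℚ) ^ ((s.choose 2 : ℤ) - (s : ℤ) * ((n : ℤ) - ((k + s : ℕ) : ℤ) - (i : ℤ))) *
      (q : ℚ) ^ ((k + 1).choose 2) =
      (q : ℚ) ^ (2 * (k + s) * (i + d)) * ((q : ℚ) ^ (s * (k + 1) + d * s))⁻¹ := by
    rw [← zpow_natCast, ← zpow_natCast, ← zpow_natCast, ← _root_.zpow_neg, ← zpow_add₀ hq0,
      ← zpow_add₀ hq0, ← zpow_add₀ hq0, choose_two_add, hn]
    congr 1
    push_cast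
    ring
  have hR : ((-q : ℚ)⁻¹) ^ (s * (k + 1)) * ((-q : ℚ)⁻¹) ^ (d * s) =
      (-1) ^ (s * (k + 1) + d * s) * ((q : ℚ) ^ (s * (k + 1) + d * s))⁻¹ := by
    rw [← pow_add, inv_pow, neg_pow, mul_inv, ← inv_pow, inv_neg_one]
  -- The two exponents differ by an even number, because `s * s` and `s` have the same parity.
  have hsign : (-1 : ℚ) ^ (s * (i + d)) * (-1) ^ (s * (k + s - i + 1)) =
      (-1) ^ s * (-1) ^ (s * (k + 1) + d * s) := by
    rw [← pow_add, ← pow_add]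
    have hki : s * (k + s - i + 1) + s * i = s * (k + s + 1) := by
      rw [← mul_add]; congr 1; omega
    apply neg_one_pow_congr
    have e1 : s * (i + d) + s * (k + s - i + 1) = (s * (k + 1) + d * s) + s * s := by
      linarith [hki, mul_add s i d, mul_add s (k + s) 1, mul_add s k s, mul_add s k 1,
        mul_comm d s]
    rw [e1, Nat.even_add, Nat.even_add (n := s * (k + 1) + d * s), Nat.even_mul (m := s)]
    tauto
  generalize (q : ℚ) ^ (2 * ((k + s : ℕ) : ℤ) * ((n : ℤ) - ((k + s : ℕ) : ℤ)) -
      ((k + s + 1).choose 2 : ℤ)) = z1 at *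
  generalize (q : ℚ) ^ ((s.choose 2 : ℤ) - (s : ℤ) * ((n : ℤ) - ((k + s : ℕ) : ℤ) - (i : ℤ))) = z2
    at *
  generalize (q : ℚ) ^ (2 * (k + s) * (i + d)) = z3 at *
  generalize ((q : ℚ) ^ (s * (k + 1) + d * s))⁻¹ = z4 at *
  generalize ((-q : ℚ)⁻¹) ^ (s * (k + 1)) = r1 at *
  generalize ((-q : ℚ)⁻¹) ^ (d * s) = r2 at *
  generalize (-1 : ℚ) ^ (s * (i + d)) = s1 at *
  generalize (-1 : ℚ) ^ (s * (k + s - i + 1)) = s2 at *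
  generalize (-1 : ℚ) ^ (s * (k + 1) + d * s) = s3 at *
  generalize gaussBinom (-q : ℚ) (k + s - i) s = b
  generalize onePlusProd (-q : ℚ)⁻¹ k = p at *
  linear_combination (z3 * (-1) ^ s * p * b) * hR - (z3 * p * b * z4) * hsign -
    (p * b * s1 * s2) * hexp - (z1 * z2 * b * s1 * s2) * h1

end Formula

/-! ### Complements of `π` and dual families. -/

section Complements

variable {K V : Type*} [Field K] [Fintype K] [StarRing K] [AddCommGroup V] [Module K V]
  {σ : K →+* K} {f : V →ₗ[K] V →ₛₗ[σ] K}

/-- The Gram matrix of a family of vectors. -/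
def gramMatrix (f : V →ₗ[K] V →ₛₗ[σ] K) {J : Type*} (t : J → V) : Matrix J J K :=
  of fun a b => f (t a) (t b)

/-- The map `v ↦ (f(v, t_b))_b`. -/
def pairingMap (f : V →ₗ[K] V →ₛₗ[σ] K) {J : Type*} (t : J → V) : V →ₗ[K] (J → K) where
  toFun v b := f v (t b)
  map_add' v w := by ext; simp
  map_smul' c v := by ext; simp

omit [Fintype K] [StarRing K] in
theorem pairingMap_apply {J : Type*} (t : J → V) (v : V) (b : J) :
    pairingMap f t v b = f v (t b) := rfl

/-- The map `v ↦ f(·, v)` is only semilinear, so injectivity is turned into surjectivity by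
finiteness of `V` and its dual, not by a rank argument. -/
theorem exists_eq_pairing [FiniteDimensional K V]
    (hsymm : ∀ v w, f v w = star (f w v)) (hnd : ∀ v, (∀ w, f v w = 0) → v = 0)
    (φ : V →ₗ[K] K) : ∃ v, ∀ x, f x v = φ x := by
  have : Finite V := Module.finite_of_finite K
  let Ψ : V → Module.Dual K V := fun v =>
    { toFun := fun x => f x v
      map_add' := fun x y => by simp
      map_smul' := fun c x => by simp }
  have hΨ : Function.Injective Ψ := by
    intro v w h
    rw [← sub_eq_zero]
    refine hnd _ fun x => ?_
    have h1 : f x v = f x w := LinearMap.congr_fun h x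
    rw [hsymm, map_sub, h1, sub_self, star_zero]
  obtain ⟨v, hv⟩ := (Finite.injective_iff_surjective_of_equiv
    (Module.finBasis K V).toDualEquiv.toEquiv).1 hΨ φ
  exact ⟨v, fun x => LinearMap.congr_fun hv x⟩

omit [Fintype K] [StarRing K] in
theorem radical_restrict_eq_bot_iff {θ : K ≃+* K} {f : V →ₗ[K] V →ₛₗ[(θ : K →+* K)] K}
    (W : Submodule K V) :
    radical (restrict f W) = ⊥ ↔ ∀ v ∈ W, (∀ w ∈ W, f v w = 0) → v = 0 := by
  rw [Submodule.eq_bot_iff]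
  constructor
  · intro h v hv hw
    exact congrArg Subtype.val (h ⟨v, hv⟩ fun w => hw w w.2)
  · intro h v hv
    exact Subtype.ext (h v v.2 fun w hw => hv ⟨w, hw⟩)

variable {J : Type*} [Fintype J] [DecidableEq J]

section DualFamily

variable {u t : J → V} (hut : ∀ a b, f (u a) (t b) = if a = b then 1 else 0)

include hut

omit [Fintype K] [StarRing K] in
theorem pairingMap_sum_smul (c : J → K) : pairingMap f t (∑ a, c a • u a) = c := by
  ext b
  rw [pairingMap_apply]
  simp [hut]

omit [Fintype K] [StarRing K] in
theorem sub_sum_mem_ker (v : V) :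
    v - ∑ a, f v (t a) • u a ∈ LinearMap.ker (pairingMap f t) := by
  rw [LinearMap.mem_ker, map_sub]
  have := pairingMap_sum_smul hut (fun a => f v (t a))
  rw [this, sub_eq_zero]
  rfl

omit [Fintype K] [StarRing K] in
theorem isCompl_ker_pairingMap :
    IsCompl (Submodule.span K (Set.range u)) (LinearMap.ker (pairingMap f t)) := by
  constructor
  · rw [Submodule.disjoint_def]
    intro x hx hx'
    obtain ⟨c, rfl⟩ := (Submodule.mem_span_range_iff_exists_fun K).1 hx
    rw [LinearMap.mem_ker, pairingMap_sum_smul hut] at hx'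
    simp [hx']
  · rw [codisjoint_iff, eq_top_iff]
    intro v _
    rw [← add_sub_cancel (∑ a, f v (t a) • u a) v]
    refine Submodule.add_mem_sup ?_ (sub_sum_mem_ker hut v)
    exact (Submodule.mem_span_range_iff_exists_fun K).2 ⟨_, rfl⟩

omit [Fintype K] in
-- The kernel is the orthogonal space of the span of `t`, so its radical is its intersection with
-- that span. In coordinates this is the left kernel of the Gram matrix.
theorem ker_pairingMap_nonsingular_iff (hσ : ∀ x, σ x = star x)
    (hsymm : ∀ v w, f v w = star (f w v)) (hnd : ∀ v, (∀ w, f v w = 0) → v = 0) :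
    (∀ v ∈ LinearMap.ker (pairingMap f t), (∀ w ∈ LinearMap.ker (pairingMap f t), f v w = 0) →
      v = 0) ↔ IsUnit (gramMatrix f t) := by
  have hgram : ∀ (c : J → K) (b : J), (c ᵥ* gramMatrix f t) b = f (∑ a, c a • t a) (t b) := by
    intro c b
    simp [vecMul, dotProduct, gramMatrix]
  have hright : ∀ (c : J → K) (x : V), f x (∑ a, c a • t a) = ∑ a, star (c a) * f x (t a) := by
    intro c x
    simp [map_sum, hσ]
  rw [← vecMul_injective_iff_isUnit]
  constructor
  · intro h
    rw [← coe_vecMulLinear, injective_iff_map_eq_zero]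
    intro c hc
    rw [vecMulLinear_apply] at hc
    have h0 : ∑ a, c a • t a = 0 := by
      refine h _ ?_ ?_
      · rw [LinearMap.mem_ker]
        ext b
        rw [pairingMap_apply, ← hgram, hc]
      · intro w hw
        rw [hsymm, hright]
        have : ∀ a, f w (t a) = 0 := fun a => congrFun (LinearMap.mem_ker.1 hw) a
        simp [this]
    ext b
    have h1 := hright c (u b)
    rw [h0, map_zero] at h1
    simpa [hut] using h1.symm
  · intro h v hv hvw
    -- Double orthogonality made explicit: tested against `x = ∑ f(x, t_a) u_a + (kernel part)`,
    -- only the `u_a` terms contribute.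
    have hv' : v = ∑ a, star (f (u a) v) • t a := by
      rw [← sub_eq_zero]
      refine hnd _ fun x => ?_
      rw [hsymm, map_sub, hright]
      have h1 := hvw _ (sub_sum_mem_ker hut x)
      rw [hsymm, star_eq_zero, map_sub, LinearMap.sub_apply, map_sum, LinearMap.sum_apply] at h1
      simp only [map_smul, LinearMap.smul_apply, smul_eq_mul] at h1
      simp only [star_star, mul_comm (f (u _) v)]
      rw [h1, star_zero]
    have hc : (fun a => star (f (u a) v)) = 0 := by
      apply h
      ext b
      dsimp only
      rw [hgram, ← hv', zero_vecMul]
      exact congrFun (LinearMap.mem_ker.1 hv) b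
    rw [hv']
    refine Finset.sum_eq_zero fun a _ => ?_
    rw [show star (f (u a) v) = 0 from congrFun hc a, zero_smul]

end DualFamily

/-- Non-singular complements of `π` correspond to families that are dual to a basis of `π` and
have an invertible Gram matrix. -/
theorem gammaCount_eq_card_dual {θ : K ≃+* K} {f : V →ₗ[K] V →ₛₗ[(θ : K →+* K)] K}
    [FiniteDimensional K V] (hσ : ∀ x, θ x = star x)
    (hsymm : ∀ v w, f v w = star (f w v)) (hnd : ∀ v, (∀ w, f v w = 0) → v = 0)
    {π : Submodule K V} (u : Basis J K π) {j k : ℕ} (hj : finrank K π = j)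
    (hk : k + j = finrank K V) :
    gammaCount f π j k = Nat.card {t : J → V //
      (∀ a b, f (u a) (t b) = if a = b then 1 else 0) ∧ IsUnit (gramMatrix f t)} := by
  have hspan : Submodule.span K (Set.range fun a => (u a : V)) = π := by
    have h1 : (Set.range fun a => (u a : V)) = π.subtype '' Set.range u := by
      rw [← Set.range_comp]; rfl
    rw [h1, Submodule.span_image, u.span_eq, Submodule.map_top, Submodule.range_subtype]
  have hfin : ∀ (W : Submodule K V) (l : ℕ), IsSingularSpace f 0 l W ↔ finrank K W = l ∧
      ∀ v ∈ W, (∀ w ∈ W, f v w = 0) → v = 0 := by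
    intro W l
    rw [IsSingularSpace, Submodule.finrank_eq_zero, radical_restrict_eq_bot_iff]
  have hcompl : ∀ t : J → V, (∀ a b, f (u a) (t b) = if a = b then 1 else 0) →
      IsCompl π (LinearMap.ker (pairingMap f t)) := by
    intro t ht
    rw [← hspan]
    exact isCompl_ker_pairingMap (u := fun a => (u a : V)) ht
  symm
  refine Nat.card_congr (Equiv.ofBijective (fun t => ⟨LinearMap.ker (pairingMap f t.1), ?_⟩) ⟨?_, ?_⟩)
  · obtain ⟨t, ht, hu⟩ := t
    have hc := hcompl t ht
    have hdim := Submodule.finrank_add_eq_of_isCompl hc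
    refine ⟨(hfin _ _).2 ⟨?_, ?_⟩, ?_, (hfin _ _).2 ⟨?_, ?_⟩⟩
    · dsimp only; omega
    · exact (ker_pairingMap_nonsingular_iff (u := fun a => (u a : V)) ht hσ hsymm hnd).2 hu
    · rw [inf_comm]; exact hc.inf_eq_bot
    · dsimp only; rw [hc.sup_eq_top, finrank_top, hk]
    · dsimp only; rw [hc.sup_eq_top]
      exact fun v _ h => hnd v fun w => h w Submodule.mem_top
  · rintro ⟨t, ht, hu⟩ ⟨t', ht', hu'⟩ h
    have hker : LinearMap.ker (pairingMap f t) = LinearMap.ker (pairingMap f t') :=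
      congrArg Subtype.val h
    rw [Subtype.mk.injEq]
    ext b
    rw [← sub_eq_zero]
    refine hnd _ fun x => ?_
    have h1 := sub_sum_mem_ker (u := fun a => (u a : V)) ht x
    rw [hker, LinearMap.mem_ker, map_sub, pairingMap_sum_smul (u := fun a => (u a : V)) ht'] at h1
    have h2 := congrFun h1 b
    rw [Pi.sub_apply, pairingMap_apply, Pi.zero_apply, sub_eq_zero] at h2
    rw [hsymm, map_sub, h2, sub_self, star_zero]
  · rintro ⟨W, hW1, hW2, hW3⟩
    rw [hfin] at hW1
    have hc : IsCompl π W := by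
      refine (Submodule.isCompl_iff_disjoint π W ?_).2 ?_
      · rw [hW1.1, hj]; omega
      · rw [disjoint_iff, inf_comm]; exact hW2
    -- The vector `t b` represents the `b`-th coordinate of the projection onto `π` along `W`.
    choose t ht using fun b => exists_eq_pairing hsymm hnd
      ((u.coord b).comp (Submodule.projectionOnto π W hc))
    have hdual : ∀ a b, f (u a) (t b) = if a = b then 1 else 0 := by
      intro a b
      rw [ht, LinearMap.comp_apply, Submodule.projectionOnto_apply_left]
      simp [Finsupp.single_apply]
    have hker : LinearMap.ker (pairingMap f t) = W := by
      ext v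
      rw [LinearMap.mem_ker, ← Submodule.projectionOnto_apply_eq_zero_iff hc,
        ← u.repr.map_eq_zero_iff, funext_iff, Finsupp.ext_iff]
      refine forall_congr' fun b => ?_
      rw [pairingMap_apply, ht]
      rfl
    refine ⟨⟨t, hdual, ?_⟩, Subtype.ext hker⟩
    rw [← ker_pairingMap_nonsingular_iff (u := fun a => (u a : V)) hdual hσ hsymm hnd, hker]
    exact hW1.2

end Complements

/-! ### Frames adapted to a singular subspace. -/

section AdaptedFrame

variable {K V : Type*} [Field K] [Fintype K] [StarRing K] [AddCommGroup V] [Module K V]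
  {q i m d : ℕ}

/-- A frame of a hermitian space adapted to a subspace `π`: a basis of `π` that consists of a basis
of its radical and an orthonormal family, a family dual to the first part, and an orthonormal
family that is orthogonal to all of these. -/
structure IsAdaptedFrame {σ : K →+* K} (f : V →ₗ[K] V →ₛₗ[σ] K) (u : Fin i ⊕ Fin m → V)
    (t₀ : Fin i → V) (w : Fin d → V) : Prop where
  rad : ∀ a b, f (u (Sum.inl a)) (u b) = 0
  orth : ∀ a b, f (u (Sum.inr a)) (u (Sum.inr b)) = if a = b then 1 else 0
  dual : ∀ a b, f (u a) (t₀ b) = if a = Sum.inl b then 1 else 0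
  perp_left : ∀ k b, f (w k) (u b) = 0
  perp_dual : ∀ k b, f (w k) (t₀ b) = 0
  orthonormal : ∀ k l, f (w k) (w l) = if k = l then 1 else 0
  complete : ∀ v, (∀ b, f v (u b) = 0) → (∀ b, f v (t₀ b) = 0) → (∀ k, f v (w k) = 0) → v = 0

/-- Any complement of the radical is non-singular, so it has an orthonormal basis. -/
theorem exists_radical_orthonormal_basis {θ : K ≃+* K} {f : V →ₗ[K] V →ₛₗ[(θ : K →+* K)] K}
    [FiniteDimensional K V] (hK : Fintype.card K = q ^ 2) (hs : ∃ x : K, star x ≠ x)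
    (hθ : ∀ x, θ x = star x) (hsymm : ∀ v w, f v w = star (f w v))
    (hrad : finrank K (radical f) = i) (hdim : finrank K V = i + m) :
    ∃ u : Basis (Fin i ⊕ Fin m) K V, (∀ a b, f (u (Sum.inl a)) (u b) = 0) ∧
      ∀ a b, f (u (Sum.inr a)) (u (Sum.inr b)) = if a = b then 1 else 0 := by
  obtain ⟨C, hC⟩ := (radical f).exists_isCompl
  have hCdim := Submodule.finrank_add_eq_of_isCompl hC
  have hnd : ∀ v : C, (∀ w : C, restrict f C v w = 0) → v = 0 := by
    intro v hv
    have hvR : (v : V) ∈ radical f := by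
      intro x
      obtain ⟨r, hr, c, hc, rfl⟩ := Submodule.mem_sup.1
        (hC.sup_eq_top.symm ▸ Submodule.mem_top : x ∈ radical f ⊔ C)
      have h1 : f v c = 0 := hv ⟨c, hc⟩
      have h2 : f r v = 0 := hr v
      rw [map_add, h1, hsymm, h2, star_zero, add_zero]
    exact Subtype.ext ((Submodule.disjoint_def.1 hC.disjoint) v hvR v.2)
  have hz : GramNondegenerate (restrict f C) (Empty.elim : Empty → C) :=
    fun c _ => Subsingleton.elim _ _
  have hsymmC : ∀ v w : C, restrict f C v w = star (restrict f C w v) := fun v w => hsymm v w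
  obtain ⟨p, -, hp, -⟩ := hz.exists_orthonormal_extension hK hs hθ hsymmC hnd m
    (by rw [Fintype.card_eq_zero, zero_add]; omega)
  have hp' : ∀ a b, f (p a) (p b) = if a = b then 1 else 0 := hp
  let r := finBasisOfFinrankEq K (radical f) hrad
  have hr : ∀ a x, f (r a) x = 0 := fun a x => (r a).2 x
  let u : Fin i ⊕ Fin m → V := Sum.elim (fun a => r a) (fun b => p b)
  have hli : LinearIndependent K u := by
    rw [Fintype.linearIndependent_iff]
    intro c hc
    rw [Fintype.sum_sum_type] at hc
    have hinr : ∀ b, c (Sum.inr b) = 0 := by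
      intro b
      have h1 := congrArg (fun v => f v (p b)) hc
      simpa [u, hr, hp'] using h1
    have hinl := Fintype.linearIndependent_iff.1 r.linearIndependent (fun a => c (Sum.inl a)) (by
      ext
      simpa [u, hinr] using hc)
    rintro (a | b)
    · exact hinl a
    · exact hinr b
  refine ⟨Basis.mk hli (hli.span_eq_top_of_card_eq_finrank' (by simp [hdim])).ge, ?_, ?_⟩
  · intro a b
    simp only [Basis.coe_mk]
    exact hr a _
  · intro a b
    simp only [Basis.coe_mk]
    exact hp' a b

theorem exists_adaptedFrame {θ : K ≃+* K} {f : V →ₗ[K] V →ₛₗ[(θ : K →+* K)] K}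
    [FiniteDimensional K V] (hK : Fintype.card K = q ^ 2) (hs : ∃ x : K, star x ≠ x)
    (hθ : ∀ x, θ x = star x) (hsymm : ∀ v w, f v w = star (f w v))
    (hnd : ∀ v, (∀ w, f v w = 0) → v = 0) {π : Submodule K V}
    (hπ : IsSingularSpace f i (i + m) π) (hdim : finrank K V = i + m + i + d) :
    ∃ (u : Basis (Fin i ⊕ Fin m) K π) (t₀ : Fin i → V) (w : Fin d → V),
      IsAdaptedFrame f (fun a => (u a : V)) t₀ w := by
  obtain ⟨u, hu1, hu2⟩ := exists_radical_orthonormal_basis (f := restrict f π) hK hs hθ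
    (fun v w => hsymm v w) hπ.2 hπ.1
  have hu1' : ∀ a b, f (u (Sum.inl a)) (u b) = 0 := hu1
  have hu2' : ∀ a b, f (u (Sum.inr a)) (u (Sum.inr b)) = if a = b then 1 else 0 := hu2
  have hu3' : ∀ a b, f (u (Sum.inr a)) (u (Sum.inl b)) = 0 := fun a b => by
    rw [hsymm, hu1', star_zero]
  obtain ⟨W, hW⟩ := π.exists_isCompl
  choose t₀ ht using fun b : Fin i => exists_eq_pairing hsymm hnd
    ((u.coord (Sum.inl b)).comp (Submodule.projectionOnto π W hW))
  have hdual : ∀ a b, f (u a) (t₀ b) = if a = Sum.inl b then 1 else 0 := by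
    intro a b
    rw [ht, LinearMap.comp_apply, Submodule.projectionOnto_apply_left]
    simp [Finsupp.single_apply]
  have hdual' : ∀ a b, f (t₀ b) (u a) = if a = Sum.inl b then 1 else 0 := by
    intro a b
    rw [hsymm, hdual]
    split_ifs <;> simp
  let z : (Fin i ⊕ Fin m) ⊕ Fin i → V := Sum.elim (fun a => u a) t₀
  -- The Gram matrix is block triangular: pairing with radical vectors isolates the `t₀`
  -- coefficients, then the orthonormal vectors and `t₀` isolate the others. Products among the `t₀`
  -- are never needed.
  have hz : GramNondegenerate f z := by
    intro c hc
    have h1 : ∀ b, c (Sum.inr b) = 0 := by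
      intro b
      have := hc (Sum.inl (Sum.inl b))
      simpa [z, Fintype.sum_sum_type, hu1', hu3', hdual'] using this
    have h2 : ∀ b, c (Sum.inl (Sum.inr b)) = 0 := by
      intro b
      have := hc (Sum.inl (Sum.inr b))
      simpa [z, Fintype.sum_sum_type, hu1', hu2', hdual'] using this
    have h3 : ∀ b, c (Sum.inl (Sum.inl b)) = 0 := by
      intro b
      have := hc (Sum.inr b)
      simpa [z, Fintype.sum_sum_type, h1, h2, hdual] using this
    ext ((b | b) | b)
    · exact h3 b
    · exact h2 b
    · exact h1 b
  obtain ⟨w, hw1, hw2, hw3⟩ := hz.exists_orthonormal_extension hK hs hθ hsymm hnd d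
    (by simp [hdim])
  refine ⟨u, t₀, w, hu1', hu2', hdual, fun k b => hw1 k (Sum.inl b), fun k b => hw1 k (Sum.inr b),
    hw2, fun v h1 h2 h3 => hw3 v ?_ h3⟩
  rintro (b | b)
  · exact h1 b
  · exact h2 b

end AdaptedFrame

/-! ### Coordinates of dual families and their Gram matrices. -/

section Coordinates

variable {K V : Type*} [Field K] [Fintype K] [StarRing K] [AddCommGroup V] [Module K V]
  {q i m d : ℕ} {σ : K →+* K} {f : V →ₗ[K] V →ₛₗ[σ] K} {u : Fin i ⊕ Fin m → V} {t₀ : Fin i → V}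
  {w : Fin d → V}

/-- The vectors dual to `u` with coordinates `C` and `x` in an adapted frame. -/
def frameFamily (u : Fin i ⊕ Fin m → V) (t₀ : Fin i → V) (w : Fin d → V)
    (C : Matrix (Fin i ⊕ Fin m) (Fin i) K) (x : Fin d → Fin i ⊕ Fin m → K) (b : Fin i ⊕ Fin m) :
    V :=
  Sum.elim t₀ (fun b => u (Sum.inr b)) b + ∑ c, C b c • u (Sum.inl c) + ∑ k, x k b • w k

omit [Fintype K] [StarRing K] in
theorem IsAdaptedFrame.dual_base (h : IsAdaptedFrame f u t₀ w) (a b : Fin i ⊕ Fin m) :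
    f (u a) ((Sum.elim t₀ (fun b => u (Sum.inr b)) : Fin i ⊕ Fin m → V) b) =
      if a = b then 1 else 0 := by
  rcases b with b | b
  · exact h.dual a b
  · rcases a with a | a
    · simpa using h.rad a _
    · simpa using h.orth a b

omit [Fintype K] in
theorem IsAdaptedFrame.dual_frameFamily (h : IsAdaptedFrame f u t₀ w)
    (hsymm : ∀ v w, f v w = star (f w v))
    (C : Matrix (Fin i ⊕ Fin m) (Fin i) K) (x : Fin d → Fin i ⊕ Fin m → K) (a b : Fin i ⊕ Fin m) :
    f (u a) (frameFamily u t₀ w C x b) = if a = b then 1 else 0 := by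
  have h1 : ∀ c, f (u a) (u (Sum.inl c)) = 0 := fun c => by rw [hsymm, h.rad, star_zero]
  have h2 : ∀ k, f (u a) (w k) = 0 := fun k => by rw [hsymm, h.perp_left, star_zero]
  simp [frameFamily, map_sum, h1, h2, h.dual_base]

omit [Fintype K] in
-- The radical vectors pair nontrivially only with `t₀`, which gives the terms in `C`; the `w k`
-- pair only among themselves, which gives the rank-one terms.
theorem IsAdaptedFrame.gramMatrix_frameFamily (h : IsAdaptedFrame f u t₀ w)
    (hσ : ∀ x, σ x = star x) (hsymm : ∀ v w, f v w = star (f w v))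
    (C : Matrix (Fin i ⊕ Fin m) (Fin i) K) (x : Fin d → Fin i ⊕ Fin m → K) :
    gramMatrix f (frameFamily u t₀ w C x) =
      gramMatrix f (Sum.elim t₀ (fun b => u (Sum.inr b))) + (fromCols C 0 + (fromCols C 0)ᴴ) +
        ∑ k, vecMulVec (x k) (star (x k)) := by
  set T : Fin i ⊕ Fin m → V := Sum.elim t₀ (fun b => u (Sum.inr b)) with hT
  have h1 : ∀ c b, f (u (Sum.inl c)) (T b) = if Sum.inl c = b then 1 else 0 := fun c b =>
    h.dual_base _ b
  have h2 : ∀ c b, f (T b) (u (Sum.inl c)) = if Sum.inl c = b then 1 else 0 := fun c b => by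
    rw [hsymm, h1]; split_ifs <;> simp
  have h3 : ∀ k b, f (w k) (T b) = 0 := by
    rintro k (b | b)
    · exact h.perp_dual k b
    · exact h.perp_left k _
  have h4 : ∀ k b, f (T b) (w k) = 0 := fun k b => by rw [hsymm, h3, star_zero]
  have h5 : ∀ k b, f (u b) (w k) = 0 := fun k b => by rw [hsymm, h.perp_left, star_zero]
  have hcols : ∀ a b, (fromCols C (0 : Matrix (Fin i ⊕ Fin m) (Fin m) K)) a b =
      ∑ c, C a c * if Sum.inl c = b then 1 else 0 := by
    rintro a (b | b) <;> simp
  ext a b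
  simp only [gramMatrix, of_apply, Matrix.add_apply, Matrix.sum_apply, vecMulVec_apply,
    conjTranspose_apply, hcols]
  simp only [frameFamily, ← hT, map_add, map_sum, LinearMap.add_apply, LinearMap.sum_apply,
    map_smul, LinearMap.smul_apply, map_smulₛₗ, hσ, smul_eq_mul, h1, h2, h3, h4, h5, h.rad,
    h.perp_left, h.orthonormal, mul_zero, Finset.sum_const_zero, add_zero, zero_add, star_sum,
    star_mul', Pi.star_apply]
  have hstar : ∀ c, star (if (Sum.inl c : Fin i ⊕ Fin m) = a then (1 : K) else 0) =
      if Sum.inl c = a then 1 else 0 := fun c => by split_ifs <;> simp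
  simp only [hstar]
  have hx : ∀ k, ∑ l, star (x l b) * (x k a * if k = l then 1 else 0) = x k a * star (x k b) := by
    intro k
    simp [mul_comm]
  simp only [Finset.mul_sum]
  rw [Finset.sum_comm]
  simp only [hx]
  ring

omit [Fintype K] in
theorem IsAdaptedFrame.frameFamily_injective (h : IsAdaptedFrame f u t₀ w)
    (hsymm : ∀ v w, f v w = star (f w v)) :
    Function.Injective fun p : Matrix (Fin i ⊕ Fin m) (Fin i) K × (Fin d → Fin i ⊕ Fin m → K) =>
      frameFamily u t₀ w p.1 p.2 := by
  rintro ⟨C, x⟩ ⟨C', x'⟩ hp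
  have hb := fun b => congrFun hp b
  simp only [frameFamily, add_assoc, add_right_inj] at hb
  have h4 : ∀ c k, f (u c) (w k) = 0 := fun c k => by rw [hsymm, h.perp_left, star_zero]
  rw [Prod.mk.injEq]
  constructor
  · ext b c
    have := congrArg (fun v => f v (t₀ c)) (hb b)
    simpa [h.dual, h.perp_dual] using this
  · ext k b
    have := congrArg (fun v => f v (w k)) (hb b)
    simpa [h4, h.orthonormal] using this

omit [Fintype K] in
-- The difference of two dual families is orthogonal to `π`. Removing its components along the
-- radical and the `w k` leaves a vector orthogonal to the whole frame, hence zero.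
theorem IsAdaptedFrame.exists_frameFamily_eq (h : IsAdaptedFrame f u t₀ w)
    (hsymm : ∀ v w, f v w = star (f w v)) {t : Fin i ⊕ Fin m → V}
    (ht : ∀ a b, f (u a) (t b) = if a = b then 1 else 0) :
    ∃ (C : Matrix (Fin i ⊕ Fin m) (Fin i) K) (x : Fin d → Fin i ⊕ Fin m → K),
      frameFamily u t₀ w C x = t := by
  set T : Fin i ⊕ Fin m → V := Sum.elim t₀ (fun b => u (Sum.inr b)) with hT
  have h4 : ∀ c k, f (u c) (w k) = 0 := fun c k => by rw [hsymm, h.perp_left, star_zero]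
  have htT : ∀ a b, f (t b - T b) (u a) = 0 := by
    intro a b
    rw [hsymm, map_sub, ht, h.dual_base, sub_self, star_zero]
  refine ⟨of fun b c => f (t b - T b) (t₀ c), fun k b => f (t b - T b) (w k), ?_⟩
  ext b
  rw [← sub_eq_zero, ← neg_eq_zero]
  have hdecomp : -(frameFamily u t₀ w (of fun b c => f (t b - T b) (t₀ c))
      (fun k b => f (t b - T b) (w k)) b - t b) = (t b - T b) -
        ∑ c, f (t b - T b) (t₀ c) • u (Sum.inl c) - ∑ k, f (t b - T b) (w k) • w k := by
    simp only [frameFamily, ← hT, of_apply]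
    abel
  rw [hdecomp]
  refine h.complete _ ?_ ?_ ?_
  · intro a
    simp only [LinearMap.map_sub, LinearMap.sub_apply, map_sum, LinearMap.sum_apply, map_smul,
      LinearMap.smul_apply, h.rad, h.perp_left, smul_zero, Finset.sum_const_zero, sub_zero]
    simpa using htT a b
  · intro c
    generalize t b - T b = v
    simp [h.dual, h.perp_dual]
  · intro k
    generalize t b - T b = v
    simp [h4, h.orthonormal]

theorem IsAdaptedFrame.card_dual (h : IsAdaptedFrame f u t₀ w)
    (hσ : ∀ x, σ x = star x) (hsymm : ∀ v w, f v w = star (f w v)) :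
    (Nat.card {t : Fin i ⊕ Fin m → V //
      (∀ a b, f (u a) (t b) = if a = b then 1 else 0) ∧ IsUnit (gramMatrix f t)} : ℚ) =
    ∑ C : Matrix (Fin i ⊕ Fin m) (Fin i) K, ∑ x : Fin d → Fin i ⊕ Fin m → K,
      nonsingInd (gramMatrix f (Sum.elim t₀ (fun b => u (Sum.inr b))) +
        (fromCols C 0 + (fromCols C 0)ᴴ) + ∑ k, vecMulVec (x k) (star (x k))) := by
  simp only [← h.gramMatrix_frameFamily hσ hsymm, nonsingInd_eq]
  rw [← Fintype.sum_prod_type' (f := fun C x =>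
    if IsUnit (gramMatrix f (frameFamily u t₀ w C x)) then (1 : ℚ) else 0), Finset.sum_boole]
  refine congrArg Nat.cast ?_
  rw [← Fintype.card_subtype, ← Nat.card_eq_fintype_card]
  symm
  refine Nat.card_congr (Equiv.ofBijective (fun p => ⟨frameFamily u t₀ w p.1.1 p.1.2,
    h.dual_frameFamily hsymm _ _, p.2⟩) ⟨?_, ?_⟩)
  · intro p p' hp
    exact Subtype.ext (h.frameFamily_injective hsymm (congrArg Subtype.val hp))
  · rintro ⟨t, ht, hu⟩
    obtain ⟨C, x, rfl⟩ := h.exists_frameFamily_eq hsymm ht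
    exact ⟨⟨(C, x), hu⟩, rfl⟩

end Coordinates

/-! ### Averaging over `C` gives the extension sum. -/

section Averaging

variable {K : Type*} [Field K] [Fintype K] [StarRing K] {J : Type*} [Fintype J]
  {ι : Type*} [Fintype ι] {κ : Type*} [Fintype κ] {q : ℕ}

theorem rankOneSum_eq [DecidableEq J] (g : Matrix J J K → ℚ) (B : Matrix J J K) :
    rankOneSum g B = ∑ x : J → K, g (B + vecMulVec x (star x)) := by
  unfold rankOneSum
  congr!

theorem sum_add_sum_rankOne [DecidableEq J] (g : Matrix J J K → ℚ) (d : ℕ) (B : Matrix J J K) :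
    ∑ x : Fin d → J → K, g (B + ∑ k, vecMulVec (x k) (star (x k))) = rankOneSum^[d] g B := by
  induction d generalizing B with
  | zero => simp
  | succ d ih =>
    rw [Function.iterate_succ_apply']
    rw [rankOneSum_eq, ← (Fin.consEquiv fun _ => J → K).sum_comp, Fintype.sum_prod_type]
    refine Finset.sum_congr rfl fun y _ => ?_
    rw [← ih]
    refine Finset.sum_congr rfl fun x _ => ?_
    simp [Fin.consEquiv, Fin.sum_univ_succ, add_assoc]

/-- The hermitian matrices that vanish on the second diagonal block. -/
def hermitianVanishing (K ι κ : Type*) [Field K] [StarRing K] :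
    AddSubgroup (Matrix (ι ⊕ κ) (ι ⊕ κ) K) where
  carrier := {S | S.IsHermitian ∧ S.submatrix Sum.inr Sum.inr = (0 : Matrix κ κ K)}
  zero_mem' := ⟨isHermitian_zero, rfl⟩
  add_mem' := fun {A B} hA hB => ⟨hA.1.add hB.1, by
    rw [submatrix_add, Pi.add_apply, Pi.add_apply, hA.2, hB.2, add_zero]⟩
  neg_mem' := fun {A} hA => ⟨hA.1.neg, by
    rw [submatrix_neg, Pi.neg_apply, Pi.neg_apply, hA.2, neg_zero]⟩

omit [Fintype K] [Fintype ι] [Fintype κ] in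
theorem mem_hermitianVanishing (S : Matrix (ι ⊕ κ) (ι ⊕ κ) K) :
    S ∈ hermitianVanishing K ι κ ↔
      S.IsHermitian ∧ S.submatrix Sum.inr Sum.inr = (0 : Matrix κ κ K) := Iff.rfl

theorem sum_hermitianVanishing [DecidableEq ι] [DecidableEq κ]
    (g : Matrix (ι ⊕ κ) (ι ⊕ κ) K → ℚ) :
    ∑ S : hermitianVanishing K ι κ, g S = extSum g Sum.inr (0 : Matrix κ κ K) := by
  unfold extSum
  exact (Finset.sum_subtype _ (fun S => by simp [mem_hermitianVanishing]) g).symm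

/-- The map `C ↦ [C 0] + [C 0]ᴴ`. -/
def addConjTransposeHom (K ι κ : Type*) [Field K] [StarRing K] :
    Matrix (ι ⊕ κ) ι K →+ hermitianVanishing K ι κ where
  toFun := fun C => ⟨fromCols C 0 + (fromCols C 0)ᴴ, isHermitian_add_transpose_self _, by
    ext a b; simp⟩
  map_zero' := by ext a b; simp
  map_add' := fun C C' => by
    have h : fromCols (C + C') (0 : Matrix (ι ⊕ κ) κ K) = fromCols C 0 + fromCols C' 0 := by
      ext a (b | b) <;> simp
    ext a b
    simp only [h, conjTranspose_add, AddSubgroup.coe_add, Matrix.add_apply]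
    ring

omit [Fintype ι] [Fintype κ] in
-- The upper diagonal block is halved by a scalar `e` of trace `1`, which also works in
-- characteristic two; the lower left block is copied.
theorem addConjTransposeHom_surjective (hs : ∃ x : K, star x ≠ x) :
    Function.Surjective (addConjTransposeHom K ι κ) := by
  obtain ⟨e, he⟩ := exists_add_star_eq_one hs
  rintro ⟨S, hS, hS0⟩
  refine ⟨fromRows (e • S.toBlocks₁₁) S.toBlocks₂₁, Subtype.ext ?_⟩
  change fromCols _ 0 + (fromCols _ 0)ᴴ = S
  have hSt : ∀ a b, star (S a b) = S b a := fun a b => hS.apply b a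
  ext (a | a) (b | b)
  · simp only [Matrix.add_apply, conjTranspose_apply, fromCols_apply_inl, fromRows_apply_inl,
      Matrix.smul_apply, smul_eq_mul, toBlocks₁₁, of_apply, star_mul', hSt]
    rw [← add_mul, he, one_mul]
  · simp [toBlocks₂₁, hSt]
  · simp [toBlocks₂₁]
  · simpa using (congrFun (congrFun hS0 a) b).symm

/-- A surjective homomorphism has fibres of equal size, so `C` may be replaced by a uniform
hermitian matrix vanishing on the last block; adding `G` makes that block the identity. -/
theorem sum_fromCols_add_conjTranspose [DecidableEq ι] [DecidableEq κ]
    (hK : Fintype.card K = q ^ 2) (hs : ∃ x : K, star x ≠ x)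
    (g : Matrix (ι ⊕ κ) (ι ⊕ κ) K → ℚ) {G : Matrix (ι ⊕ κ) (ι ⊕ κ) K} (hG : G.IsHermitian)
    (hG1 : G.submatrix Sum.inr Sum.inr = (1 : Matrix κ κ K)) :
    (∑ C : Matrix (ι ⊕ κ) ι K, g (G + (fromCols C 0 + (fromCols C 0)ᴴ))) *
        (q : ℚ) ^ (2 * Fintype.card ι * Fintype.card κ + (Fintype.card ι) ^ 2) =
      (q : ℚ) ^ (2 * (Fintype.card ι + Fintype.card κ) * Fintype.card ι) *
        extSum g Sum.inr (1 : Matrix κ κ K) := by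
  have h1 := sum_comp_addMonoidHom _ (addConjTransposeHom_surjective (K := K) (ι := ι) (κ := κ) hs)
    (fun S => g (G + S))
  have h2 := sum_hermitianVanishing (K := K) (ι := ι) (κ := κ) (fun S => g (S + G))
  rw [extSum_translate _ _ _ hG, hG1, zero_add] at h2
  have h3 := sum_hermitianVanishing (K := K) (ι := ι) (κ := κ) (fun _ => 1)
  have h5 : (∑ _S : hermitianVanishing K ι κ, (1 : ℚ)) =
      Fintype.card (hermitianVanishing K ι κ) := by
    rw [Finset.sum_const, nsmul_eq_mul, mul_one, Finset.card_univ]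
  rw [extSum_one_inr hK hs, h5] at h3
  rw [← h3, ← h2]
  have h4 : (Fintype.card (Matrix (ι ⊕ κ) ι K) : ℚ) =
      (q : ℚ) ^ (2 * (Fintype.card ι + Fintype.card κ) * Fintype.card ι) := by
    rw [show Fintype.card (Matrix (ι ⊕ κ) ι K) = Fintype.card (ι ⊕ κ → ι → K) from
      Fintype.card_congr (Equiv.refl _),
      Fintype.card_fun, Fintype.card_fun, hK, Fintype.card_sum]
    push_cast
    ring
  rw [← h4]
  simp only [add_comm _ G]
  exact h1

end Averaging

/-! ### Assembly. -/

section Main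

variable {K V : Type*} [Field K] [Fintype K] [StarRing K] [AddCommGroup V] [Module K V]
  {q i m d : ℕ}

theorem gammaCount_eq_complementSum {θ : K ≃+* K} {f : V →ₗ[K] V →ₛₗ[(θ : K →+* K)] K}
    [FiniteDimensional K V] (hq : 2 ≤ q) (hK : Fintype.card K = q ^ 2) (hs : ∃ x : K, star x ≠ x)
    (hθ : ∀ x, θ x = star x) (hsymm : ∀ v w, f v w = star (f w v))
    (hnd : ∀ v, (∀ w, f v w = 0) → v = 0) {π : Submodule K V}
    (hπ : IsSingularSpace f i (i + m) π) (hdim : finrank K V = i + m + i + d) :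
    (gammaCount f π (i + m) (i + d) : ℚ) =
      (q : ℚ) ^ (2 * (i + m) * (i + d)) * complementSum (-q) (i + m) m d := by
  have hq0 : (q : ℚ) ≠ 0 := by positivity
  obtain ⟨u, t₀, w, h⟩ := exists_adaptedFrame hK hs hθ hsymm hnd hπ hdim
  rw [gammaCount_eq_card_dual hθ hsymm hnd u hπ.1 (by omega), h.card_dual hθ hsymm]
  simp only [sum_add_sum_rankOne]
  set G := gramMatrix f (Sum.elim t₀ (fun b => (u (Sum.inr b) : V))) with hGdef
  have hG : G.IsHermitian := by
    ext a b
    exact (hsymm _ _).symm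
  have hG1 : G.submatrix Sum.inr Sum.inr = (1 : Matrix (Fin m) (Fin m) K) := by
    ext a b
    exact h.orth a b
  have h1 := sum_fromCols_add_conjTranspose hK hs
    (rankOneSum^[d] (nonsingInd : Matrix (Fin i ⊕ Fin m) (Fin i ⊕ Fin m) K → ℚ)) hG hG1
  have h2 := extSum_iterate_nonsingInd (K := K) (J := Fin i ⊕ Fin m) hK hs hq
    (j := i + m) (by simp) d m (ε := Sum.inr) Sum.inr_injective
  simp only [Fintype.card_fin] at h1
  have hne : (q : ℚ) ^ (2 * i * m + i ^ 2) * q ^ (m ^ 2) ≠ 0 :=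
    mul_ne_zero (pow_ne_zero _ hq0) (pow_ne_zero _ hq0)
  rw [← mul_left_inj' hne, ← mul_assoc, h1, mul_assoc, h2]
  ring

end Main

end HermitianAnzahl

theorem mainTheorem2 {K V : Type*} [Field K] [Fintype K] [AddCommGroup V] [Module K V]
    (q : ℕ) (hq : IsPrimePow q) (hK : Fintype.card K = q ^ 2)
    (i j n : ℕ) (hV : Module.finrank K V = n)
    (hi : i ≤ min j (n - j)) (hj : j + 1 ≤ n)
    (θ : K ≃+* K) (f : V →ₗ[K] V →ₛₗ[(θ : K →+* K)] K)
    (hf : HermitianAnzahl.IsHermitian f) (hnd : HermitianAnzahl.IsNondegenerate f)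
    (π : Submodule K V) (hπ : HermitianAnzahl.IsSingularSpace f i j π) :
    (HermitianAnzahl.gammaCount f π j (n - j) : ℚ) =
      (q : ℚ) ^ (2 * (j : ℤ) * ((n : ℤ) - (j : ℤ)) - ((j + 1).choose 2 : ℤ)) *
        HermitianAnzahl.phiPlus 1 i q *
        ∑ m ∈ Finset.range (j - i + 1),
          (-1 : ℚ) ^ (m * (n - j)) * HermitianAnzahl.phiPlus (i + 1) (j - m) q *
            HermitianAnzahl.gaussMinus (j - i) m q *
            (q : ℚ) ^ ((m.choose 2 : ℤ) - (m : ℤ) * ((n : ℤ) - (j : ℤ) - (i : ℤ))) := by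
  let _ : StarRing K :=
    { star := θ
      star_involutive := fun x => RingEquiv.congr_fun hf.sq_eq_one x
      star_mul := fun x y => by rw [map_mul, mul_comm]
      star_add := fun x y => map_add θ x y }
  have hs : ∃ x : K, star x ≠ x := by
    by_contra! h
    exact hf.ne_one (RingEquiv.ext h)
  -- The bound `j + 1 ≤ n` makes `finrank` positive, which excludes its default value `0` in
  -- infinite dimension.
  have : FiniteDimensional K V := FiniteDimensional.of_finrank_pos (by omega)
  have hnd' : ∀ v, (∀ w, f v w = 0) → v = 0 := fun v hv =>
    (Submodule.eq_bot_iff _).1 hnd v hv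
  have hi1 : i ≤ j := hi.trans (min_le_left _ _)
  have hi2 : i ≤ n - j := hi.trans (min_le_right _ _)
  obtain ⟨m, rfl⟩ := Nat.exists_eq_add_of_le hi1
  obtain ⟨d, hd⟩ := Nat.exists_eq_add_of_le hi2
  have hn : n = i + m + i + d := by omega
  rw [← HermitianAnzahl.complementSum_eq_formula hq.two_le hi1 hn, Nat.add_sub_cancel_left, hd]
  exact HermitianAnzahl.gammaCount_eq_complementSum hq.two_le hK hs (fun _ => rfl) hf.symm hnd' hπ
    (hV.trans hn)
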